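/- Let $\varphi(\xi)=\frac{\xi}{1+\xi^2}$ and let $S(t)=e^{-it\varphi(D)}$, $t\in\mathbb{R}$, be the linear BBM group on $\mathbb{R}$, that is, $\widehat{S(t)f}(\xi)=e^{-it\varphi(\xi)}\widehat f(\xi)$, where $\widehat f(\xi)=\int_{\mathbb{R}}e^{-ix\xi}f(x)\,dx$. For $\sigma\in\mathbb{R}$ and $1\le p\le\infty$ let $\|u\|_{H^\sigma_p}=\|J^\sigma u\|_{L^p(\mathbb{R})}$, where $J^\sigma=(1-\partial_x^2)^{\sigma/2}$ is the Fourier multiplier with symbol $(1+\xi^2)^{\sigma/2}$. For $\sigma<-1$ put \[ \beta_\sigma=\begin{cases}\dfrac{\sigma+1}{1-2\sigma}, & -4\le\sigma<-1,\\[2mm] \dfrac{-3}{1-2\sigma}, & \sigma\le-4.\end{cases} \] Then for every $\sigma<-1$ there is a constant $C_\sigma>0$, depending only on $\sigma$, such that for all $2\le p\le\infty$ with $\frac1p+\frac1{p'}=1$, \[ \|S(t)f\|_{H^\sigma_p}\le C_\sigma\,|t|^{2\left(\frac12-\frac1p\right)\beta_\sigma}\,\|f\|_{L^{p'}} \] for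 all Schwartz functions $f\in\mathscr{S}(\mathbb{R})$ and all $t\neq0$. -/

import Mathlib

open MeasureTheory
open scoped ENNReal SchwartzMap

noncomputable section

namespace BBM

/-- The exponent `β_σ` (for `σ < -1`): `(σ + 1) / (1 - 2σ)` if `-4 ≤ σ`, and `-3 / (1 - 2σ)` if
`σ ≤ -4`; the two formulas agree at `σ = -4`. -/
def beta (σ : ℝ) : ℝ :=
  if -4 ≤ σ then (σ + 1) / (1 - 2 * σ) else -3 / (1 - 2 * σ)

/-- The dispersion relation `φ(ξ) = ξ / (1 + ξ²)`. -/
def phi (ξ : ℝ) : ℝ := ξ / (1 + ξ ^ 2)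

/-- The Fourier multiplier `m(D)`, `D = -i d/dx`, on tempered distributions on `ℝ`. Mathlib's
Fourier transform is `∫ e^{-2πixξ} f(x) dx`, for which `D` has the symbol `2πξ`. The definition is
meaningful for symbols of temperate growth. -/
def multiplier (m : ℝ → ℂ) : 𝓢'(ℝ, ℂ) →L[ℂ] 𝓢'(ℝ, ℂ) :=
  TemperedDistribution.fourierMultiplierCLM ℂ (fun ξ : ℝ ↦ m (2 * Real.pi * ξ))

/-- The symbol `e^{-itφ(ξ)}`. -/
def groupSymbol (t : ℝ) (ξ : ℝ) : ℂ := Complex.exp (-Complex.I * t * phi ξ)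

/-- The symbol `(1 + ξ²)^{σ/2}`. -/
def besselSymbol (σ : ℝ) (ξ : ℝ) : ℂ := ((1 + ξ ^ 2) ^ (σ / 2) : ℝ)

/-- The BBM group `S(t) = e^{-itφ(D)}`. -/
def group (t : ℝ) : 𝓢'(ℝ, ℂ) →L[ℂ] 𝓢'(ℝ, ℂ) := multiplier (groupSymbol t)

/-- The Bessel potential `J^σ = (1 - d²/dx²)^{σ/2}`. (Mathlib's `besselPotential` is
`(1 - (2π)⁻² d²/dx²)^{σ/2}`.) -/
def bessel (σ : ℝ) : 𝓢'(ℝ, ℂ) →L[ℂ] 𝓢'(ℝ, ℂ) := multiplier (besselSymbol σ)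

/-- The norm `‖u‖_{H^σ_p} = ‖J^σ u‖_{L^p}` of a tempered distribution `u`, for `1 ≤ p ≤ ∞`. It is
the `L^p` norm of the function `g ∈ L^p` (unique almost everywhere) that represents `J^σ u`, and
`∞` if there is none. -/
def sobolevNorm (σ : ℝ) (p : ℝ≥0∞) (u : 𝓢'(ℝ, ℂ)) : ℝ≥0∞ :=
  ⨅ (g : ℝ → ℂ) (_ : MemLp g p volume)
    (_ : ∀ ψ : 𝓢(ℝ, ℂ), bessel σ u ψ = ∫ x, ψ x * g x), eLpNorm g p volume

/-! The symbols above have temperate growth, so that the operators are the intended ones. -/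

theorem hasTemperateGrowth_exp_I :
    (fun x : ℝ ↦ Complex.exp (x * Complex.I)).HasTemperateGrowth := by
  have hd : ∀ n : ℕ, iteratedDeriv n (fun x : ℝ ↦ Complex.exp (x * Complex.I)) =
      fun x : ℝ ↦ Complex.I ^ n * Complex.exp (x * Complex.I) := by
    intro n
    induction n with
    | zero => simp
    | succ n ih =>
      rw [iteratedDeriv_succ, ih]
      funext x
      have h1 : HasDerivAt (fun x : ℝ ↦ (x : ℂ) * Complex.I) Complex.I x := by
        simpa using (Complex.ofRealCLM.hasDerivAt (x := x)).mul_const Complex.I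
      have h2 := (h1.cexp).const_mul (Complex.I ^ n)
      rw [h2.deriv]
      ring
  refine ⟨?_, fun n ↦ ⟨0, 1, fun x ↦ ?_⟩⟩
  · exact (Complex.ofRealCLM.contDiff.mul contDiff_const).cexp
  · rw [norm_iteratedFDeriv_eq_norm_iteratedDeriv, hd]
    simp [Complex.norm_exp]

theorem hasTemperateGrowth_one_add_sq_rpow (r : ℝ) :
    (fun ξ : ℝ ↦ (1 + (2 * Real.pi * ξ) ^ 2) ^ r).HasTemperateGrowth := by
  have h := (Function.hasTemperateGrowth_one_add_norm_sq_rpow ℝ r).comp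
    (f := fun ξ : ℝ ↦ 2 * Real.pi * ξ) (by fun_prop)
  simpa [Function.comp_def, Real.norm_eq_abs, sq_abs] using h

theorem hasTemperateGrowth_besselSymbol (σ : ℝ) :
    (fun ξ : ℝ ↦ besselSymbol σ (2 * Real.pi * ξ)).HasTemperateGrowth :=
  Function.Complex.hasTemperateGrowth_ofReal.comp (hasTemperateGrowth_one_add_sq_rpow (σ / 2))

theorem hasTemperateGrowth_groupSymbol (t : ℝ) :
    (fun ξ : ℝ ↦ groupSymbol t (2 * Real.pi * ξ)).HasTemperateGrowth := by
  have h1 := hasTemperateGrowth_one_add_sq_rpow (-1)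
  have h2 : (fun ξ : ℝ ↦ (-t * (2 * Real.pi * ξ)) *
      (1 + (2 * Real.pi * ξ) ^ 2) ^ (-1 : ℝ)).HasTemperateGrowth := by
    refine Function.HasTemperateGrowth.mul ?_ h1
    fun_prop
  convert hasTemperateGrowth_exp_I.comp h2 using 1
  funext ξ
  simp only [groupSymbol, phi, Function.comp_def, Real.rpow_neg_one]
  congr 1
  push_cast
  ring

end BBM

end

/-! The operator `J^σ S(t)` is the Fourier multiplier with symbol `e^{-itφ(ξ)} (1 + ξ²)^{σ/2}`,
which is integrable because `σ < -1`. The modulus of the symbol is at most `1`, so Plancherel gives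
the `L²` bound with constant `1`. If the kernel is bounded by a multiple of `|t|^β_σ`, the `L¹ →
L^∞` bound follows, and Riesz–Thorin yields the estimate for `2 ≤ p ≤ ∞`.

The kernel is an oscillatory integral with phase `xη - tφ(η)`, whose second derivative `-tφ''(η)`
does not involve `x`; van der Corput's lemma therefore gives bounds uniform in `x`. On `η ≥ 0`, `φ''
= 2η(η² - 3)/(1 + η²)³` has simple zeros at `0` and `√3`. Removing neighbourhoods of width about
`|t|^{-1/3}` costs `|t|^{-1/3}`, and so does the rest of `[0, 3]`. For large `η`, `φ''` decays like
`η⁻³`: the part up to `N` costs `|t|^{-1/2} N^{3/2}` and the tail costs `N^{σ+1}`. These balance at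
`N ~ |t|^{1/(1-2σ)}`, with the common value `|t|^{(σ+1)/(1-2σ)}`. For `|t| ≥ 1` both rates are at
most `|t|^β_σ`; for `|t| < 1` the trivial bound suffices since `β_σ ≤ 0`. The outcome is
`exists_norm_integral_kernelIntegrand_le`.

Interpolation is carried out for the bilinear form `∫ (m(D) f) g` (`norm_bilinear_le`), and duality
converts it into the `L^{p'} → L^p` bound `eLpNorm_fourierMultiplier_le`. -/

namespace BBM

/-! ### Van der Corput estimates -/

/-- First-derivative van der Corput estimate with a decreasing weight. -/
theorem norm_integral_exp_mul_le_of_le_deriv {f f' f'' w w' : ℝ → ℝ} {a b μ ε : ℝ} (hab : a ≤ b)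
    (hμ : 0 < μ) (hε : |ε| = 1)
    (hf : ∀ x, HasDerivAt f (f' x) x) (hf' : ∀ x, HasDerivAt f' (f'' x) x) (hf'' : Continuous f'')
    (hw : ∀ x, HasDerivAt w (w' x) x) (hw' : Continuous w')
    (h1 : ∀ x ∈ Set.Icc a b, μ ≤ f' x) (h2 : ∀ x ∈ Set.Icc a b, 0 ≤ ε * f'' x)
    (hw0 : ∀ x ∈ Set.Icc a b, 0 ≤ w x) (hw1 : ∀ x ∈ Set.Icc a b, w x ≤ 1)
    (hwd : ∀ x ∈ Set.Icc a b, w' x ≤ 0) :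
    ‖∫ x in a..b, Complex.exp (f x * Complex.I) * w x‖ ≤ 4 / μ := by
  have hcf : Continuous f := continuous_iff_continuousAt.2 fun x ↦ (hf x).continuousAt
  have hcf' : Continuous f' := continuous_iff_continuousAt.2 fun x ↦ (hf' x).continuousAt
  have hcw : Continuous w := continuous_iff_continuousAt.2 fun x ↦ (hw x).continuousAt
  have hpos : ∀ x ∈ Set.Icc a b, 0 < f' x := fun x hx ↦ hμ.trans_le (h1 x hx)
  have hne : ∀ x ∈ Set.uIcc a b, f' x ≠ 0 := fun x hx ↦
    (hpos x (by rwa [Set.uIcc_of_le hab] at hx)).ne'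
  have ha : a ∈ Set.Icc a b := Set.left_mem_Icc.2 hab
  have hb : b ∈ Set.Icc a b := Set.right_mem_Icc.2 hab
  set G : ℝ → ℝ := fun x ↦ w x / f' x with hG
  set G' : ℝ → ℝ := fun x ↦ (w' x * f' x - w x * f'' x) / f' x ^ 2 with hG'
  have hGd : ∀ x ∈ Set.uIcc a b, HasDerivAt G (G' x) x := fun x hx ↦
    (hw x).div (hf' x) (hne x hx)
  have hE : ∀ x, HasDerivAt (fun x ↦ Complex.exp (f x * Complex.I))
      (Complex.exp (f x * Complex.I) * (f' x * Complex.I)) x := fun x ↦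
    ((hf x).ofReal_comp.mul_const Complex.I).cexp
  have hG'c : ContinuousOn G' (Set.uIcc a b) :=
    ContinuousOn.div (by fun_prop) (by fun_prop) fun x hx ↦ pow_ne_zero _ (hne x hx)
  have hEc : Continuous fun x ↦ Complex.exp (f x * Complex.I) := by fun_prop
  have hI1 : IntervalIntegrable (fun x ↦ Complex.exp (f x * Complex.I) * w x) volume a b :=
    Continuous.intervalIntegrable (by fun_prop) _ _
  have hI2 : IntervalIntegrable (fun x ↦ Complex.exp (f x * Complex.I) * (-Complex.I * G' x))
      volume a b := by
    apply ContinuousOn.intervalIntegrable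
    exact hEc.continuousOn.mul (continuousOn_const.mul
      (Complex.continuous_ofReal.comp_continuousOn hG'c))
  have key := intervalIntegral.integral_eq_sub_of_hasDerivAt (a := a) (b := b)
    (f := fun x ↦ Complex.exp (f x * Complex.I) * (-Complex.I * G x))
    (f' := fun x ↦ Complex.exp (f x * Complex.I) * w x +
      Complex.exp (f x * Complex.I) * (-Complex.I * G' x)) (fun x hx ↦ by
      have h := (hE x).mul ((hGd x hx).ofReal_comp.const_mul (-Complex.I))
      refine h.congr_deriv ?_
      have : (f' x : ℂ) ≠ 0 := by exact_mod_cast hne x hx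
      simp only [hG]
      push_cast
      field_simp
      ring_nf
      simp) (hI1.add hI2)
  rw [intervalIntegral.integral_add hI1 hI2] at key
  have hnE : ∀ x : ℝ, ‖Complex.exp (f x * Complex.I)‖ = 1 := fun x ↦ Complex.norm_exp_ofReal_mul_I _
  have hbd : ∀ x ∈ Set.Icc a b,
      ‖Complex.exp (f x * Complex.I) * (-Complex.I * G x)‖ ≤ 1 / μ := by
    intro x hx
    rw [norm_mul, hnE, norm_mul, norm_neg, Complex.norm_I, Complex.norm_real, one_mul, one_mul,
      Real.norm_eq_abs, abs_of_nonneg (div_nonneg (hw0 x hx) (hpos x hx).le)]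
    exact div_le_div₀ zero_le_one (hw1 x hx) hμ (h1 x hx)
  -- An explicit primitive of a majorant of `|G'|`: `w` and `f'` are both monotone, so each of the
  -- two terms telescopes and contributes at most `1 / μ`.
  have hH : ∀ x ∈ Set.uIcc a b, HasDerivAt (fun x ↦ -(w x) / μ - ε * (f' x)⁻¹)
      (-(w' x) / μ + ε * (f'' x / f' x ^ 2)) x := fun x hx ↦ by
    refine (((hw x).neg.div_const μ).sub (((hf' x).inv (hne x hx)).const_mul ε)).congr_deriv ?_
    ring
  have hHc : ContinuousOn (fun x ↦ -(w' x) / μ + ε * (f'' x / f' x ^ 2)) (Set.uIcc a b) := by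
    refine ContinuousOn.add (by fun_prop) (continuousOn_const.mul ?_)
    exact ContinuousOn.div (by fun_prop) (by fun_prop) fun x hx ↦ pow_ne_zero _ (hne x hx)
  have hHint := intervalIntegral.integral_eq_sub_of_hasDerivAt hH hHc.intervalIntegrable
  have hle : ‖∫ x in a..b, Complex.exp (f x * Complex.I) * (-Complex.I * G' x)‖ ≤ 2 / μ := by
    have h3 : ‖∫ x in a..b, Complex.exp (f x * Complex.I) * (-Complex.I * G' x)‖ ≤
        ∫ x in a..b, -(w' x) / μ + ε * (f'' x / f' x ^ 2) := by
      refine intervalIntegral.norm_integral_le_of_norm_le hab ?_ hHc.intervalIntegrable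
      refine Filter.Eventually.of_forall fun x hx ↦ ?_
      have hx' : x ∈ Set.Icc a b := Set.Ioc_subset_Icc_self hx
      have hp := hpos x hx'
      rw [norm_mul, hnE, norm_mul, norm_neg, Complex.norm_I, Complex.norm_real, one_mul, one_mul,
        Real.norm_eq_abs]
      have e1 : G' x = w' x / f' x - w x * (f'' x / f' x ^ 2) := by
        simp only [hG']; field_simp
      have e2 : |w' x / f' x| ≤ -(w' x) / μ := by
        rw [abs_div, abs_of_nonpos (hwd x hx'), abs_of_pos hp]
        exact div_le_div_of_nonneg_left (by linarith [hwd x hx']) hμ (h1 x hx')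
      have e3 : |w x * (f'' x / f' x ^ 2)| ≤ ε * (f'' x / f' x ^ 2) := by
        have : |f'' x| = ε * f'' x := by
          rw [← abs_of_nonneg (h2 x hx'), abs_mul, hε, one_mul]
        rw [abs_mul, abs_div, this, abs_of_pos (pow_pos hp 2), abs_of_nonneg (hw0 x hx'),
          ← mul_div_assoc ε]
        exact mul_le_of_le_one_left (div_nonneg (h2 x hx') (sq_nonneg _)) (hw1 x hx')
      rw [e1]
      exact (abs_sub _ _).trans (add_le_add e2 e3)
    refine h3.trans ?_
    rw [hHint]
    have i1 := inv_anti₀ hμ (h1 a ha)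
    have i2 := inv_anti₀ hμ (h1 b hb)
    have j1 := inv_pos.2 (hpos a ha)
    have j2 := inv_pos.2 (hpos b hb)
    have k : ε * ((f' a)⁻¹ - (f' b)⁻¹) ≤ μ⁻¹ := by
      refine (le_abs_self _).trans ?_
      rw [abs_mul, hε, one_mul, abs_le]
      constructor <;> linarith
    have l : (w a - w b) * μ⁻¹ ≤ 1 * μ⁻¹ :=
      mul_le_mul_of_nonneg_right (by linarith [hw1 a ha, hw0 b hb]) (inv_pos.2 hμ).le
    simp only [div_eq_mul_inv]
    linarith
  have : ∫ x in a..b, Complex.exp (f x * Complex.I) * w x =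
      Complex.exp (f b * Complex.I) * (-Complex.I * G b) -
      Complex.exp (f a * Complex.I) * (-Complex.I * G a) -
      ∫ x in a..b, Complex.exp (f x * Complex.I) * (-Complex.I * G' x) := by
    rw [← key]; ring
  rw [this]
  refine (norm_sub_le _ _).trans ((add_le_add ((norm_sub_le _ _).trans
    (add_le_add (hbd b hb) (hbd a ha))) hle).trans (le_of_eq (by ring)))

theorem norm_integral_exp_neg_mul {f w : ℝ → ℝ} (a b : ℝ) :
    ‖∫ x in a..b, Complex.exp ((-f x : ℝ) * Complex.I) * w x‖ =
      ‖∫ x in a..b, Complex.exp (f x * Complex.I) * w x‖ := by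
  rw [← RCLike.norm_conj (∫ x in a..b, Complex.exp (f x * Complex.I) * w x),
    intervalIntegral.intervalIntegral_eq_integral_uIoc,
    intervalIntegral.intervalIntegral_eq_integral_uIoc, RCLike.conj_smul, ← integral_conj]
  simp only [map_mul, ← Complex.exp_conj, Complex.conj_ofReal, Complex.conj_I, Complex.ofReal_neg,
    neg_mul, mul_neg]

/-- Second-derivative van der Corput estimate with a decreasing weight. -/
theorem norm_integral_exp_mul_le_of_le_deriv2 {f f' f'' w w' : ℝ → ℝ} {a b l : ℝ} (hab : a ≤ b)
    (hl : 0 < l)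
    (hf : ∀ x, HasDerivAt f (f' x) x) (hf' : ∀ x, HasDerivAt f' (f'' x) x) (hf'' : Continuous f'')
    (hw : ∀ x, HasDerivAt w (w' x) x) (hw' : Continuous w')
    (h2 : ∀ x ∈ Set.Icc a b, l ≤ f'' x)
    (hw0 : ∀ x ∈ Set.Icc a b, 0 ≤ w x) (hw1 : ∀ x ∈ Set.Icc a b, w x ≤ 1)
    (hwd : ∀ x ∈ Set.Icc a b, w' x ≤ 0) :
    ‖∫ x in a..b, Complex.exp (f x * Complex.I) * w x‖ ≤ 10 / √l := by
  have hcf : Continuous f := continuous_iff_continuousAt.2 fun x ↦ (hf x).continuousAt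
  have hcf' : Continuous f' := continuous_iff_continuousAt.2 fun x ↦ (hf' x).continuousAt
  have hcw : Continuous w := continuous_iff_continuousAt.2 fun x ↦ (hw x).continuousAt
  have hs : 0 < √l := Real.sqrt_pos.2 hl
  have hss : √l * √l = l := Real.mul_self_sqrt hl.le
  have hmono : ∀ x ∈ Set.Icc a b, ∀ y ∈ Set.Icc a b, x ≤ y → l * (y - x) ≤ f' y - f' x := by
    refine (convex_Icc a b).mul_sub_le_image_sub_of_le_deriv hcf'.continuousOn
      (fun x _ ↦ (hf' x).differentiableAt.differentiableWithinAt) fun x hx ↦ ?_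
    rw [(hf' x).deriv]
    exact h2 x (interior_subset hx)
  have hI : ∀ c d, IntervalIntegrable (fun x ↦ Complex.exp (f x * Complex.I) * w x) volume c d :=
    fun c d ↦ Continuous.intervalIntegrable (by fun_prop) _ _
  -- `z` is the zero of the increasing function `f'`, or the endpoint nearest to it. At distance at
  -- least `1 / √l` from `z` one has `|f'| ≥ √l`, so the first-derivative estimate gives `4 / √l` on
  -- each side; the middle piece has length at most `2 / √l`.
  obtain ⟨z, hz, hzr, hzl⟩ : ∃ z ∈ Set.Icc a b, (∀ x ∈ Set.Icc a b, z < x → l * (x - z) ≤ f' x) ∧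
      (∀ x ∈ Set.Icc a b, x < z → l * (z - x) ≤ - f' x) := by
    have ha := Set.left_mem_Icc.2 hab
    have hb := Set.right_mem_Icc.2 hab
    rcases le_or_gt 0 (f' a) with h0 | h0
    · exact ⟨a, ha, fun x hx hax ↦ by linarith [hmono a ha x hx hax.le],
        fun x hx hxa ↦ absurd hx.1 (not_le.2 hxa)⟩
    rcases le_or_gt (f' b) 0 with h1 | h1
    · exact ⟨b, hb, fun x hx hbx ↦ absurd hx.2 (not_le.2 hbx),
        fun x hx hxb ↦ by linarith [hmono x hx b hb hxb.le]⟩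
    obtain ⟨z, hz, hz0⟩ := intermediate_value_Icc hab hcf'.continuousOn ⟨h0.le, h1.le⟩
    exact ⟨z, hz, fun x hx hzx ↦ by linarith [hmono z hz x hx hzx.le],
      fun x hx hxz ↦ by linarith [hmono x hx z hz hxz.le]⟩
  have hr : 0 < 1 / √l := by positivity
  have hlr : l * (1 / √l) = √l := by
    rw [← hss]; field_simp; simp
  set c := max a (z - 1 / √l) with hc
  set d := min b (z + 1 / √l) with hd
  have hac : a ≤ c := le_max_left _ _
  have hcz : c ≤ z := max_le hz.1 (by linarith)
  have hzd : z ≤ d := le_min hz.2 (by linarith)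
  have hdb : d ≤ b := min_le_left _ _
  have hl1 : ‖∫ x in a..c, Complex.exp (f x * Complex.I) * w x‖ ≤ 4 / √l := by
    rcases hac.eq_or_lt with h | h
    · rw [← h, intervalIntegral.integral_same, norm_zero]; positivity
    have hc' : c = z - 1 / √l := by
      rcases max_choice a (z - 1 / √l) with h' | h'
      · exact absurd (hc.trans h') h.ne'
      · exact hc.trans h'
    have hsub : Set.Icc a c ⊆ Set.Icc a b := Set.Icc_subset_Icc_right (hcz.trans hz.2)
    rw [← norm_integral_exp_neg_mul]
    refine norm_integral_exp_mul_le_of_le_deriv (f' := fun x ↦ -f' x) (f'' := fun x ↦ -f'' x)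
      (ε := -1) hac hs (by simp) (fun x ↦ (hf x).neg) (fun x ↦ (hf' x).neg) hf''.neg hw hw'
      (fun x hx ↦ ?_) (fun x hx ↦ ?_) (fun x hx ↦ hw0 x (hsub hx)) (fun x hx ↦ hw1 x (hsub hx))
      (fun x hx ↦ hwd x (hsub hx))
    · have h3 := hx.2
      refine le_trans ?_ (hzl x (hsub hx) (by linarith))
      rw [← hlr]
      exact mul_le_mul_of_nonneg_left (by linarith) hl.le
    · linarith [h2 x (hsub hx)]
  have hl2 : ‖∫ x in d..b, Complex.exp (f x * Complex.I) * w x‖ ≤ 4 / √l := by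
    rcases hdb.eq_or_lt with h | h
    · rw [h, intervalIntegral.integral_same, norm_zero]; positivity
    have hd' : d = z + 1 / √l := by
      rcases min_choice b (z + 1 / √l) with h' | h'
      · exact absurd (hd.trans h') h.ne
      · exact hd.trans h'
    have hsub : Set.Icc d b ⊆ Set.Icc a b := Set.Icc_subset_Icc_left (hz.1.trans hzd)
    refine norm_integral_exp_mul_le_of_le_deriv
      (ε := 1) hdb hs (by simp) hf hf' hf'' hw hw'
      (fun x hx ↦ ?_) (fun x hx ↦ ?_) (fun x hx ↦ hw0 x (hsub hx)) (fun x hx ↦ hw1 x (hsub hx))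
      (fun x hx ↦ hwd x (hsub hx))
    · have h3 := hx.1
      refine le_trans ?_ (hzr x (hsub hx) (by linarith))
      rw [← hlr]
      exact mul_le_mul_of_nonneg_left (by linarith) hl.le
    · linarith [h2 x (hsub hx)]
  have hm : ‖∫ x in c..d, Complex.exp (f x * Complex.I) * w x‖ ≤ 2 / √l := by
    have hcd : c ≤ d := hcz.trans hzd
    have := intervalIntegral.norm_integral_le_of_norm_le_const (a := c) (b := d) (C := 1)
      (f := fun x ↦ Complex.exp (f x * Complex.I) * w x) (fun x hx ↦ by
        rw [Set.uIoc_of_le hcd] at hx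
        have hx' : x ∈ Set.Icc a b := ⟨hac.trans hx.1.le, hx.2.trans hdb⟩
        rw [norm_mul, Complex.norm_exp_ofReal_mul_I, one_mul, Complex.norm_real, Real.norm_eq_abs,
          abs_of_nonneg (hw0 x hx')]
        exact hw1 x hx')
    refine this.trans ?_
    rw [one_mul, abs_of_nonneg (by linarith)]
    have h3 : z - 1 / √l ≤ c := le_max_right _ _
    have h4 : d ≤ z + 1 / √l := min_le_right _ _
    linarith [show (2 : ℝ) / √l = 1 / √l + 1 / √l by ring]
  rw [← intervalIntegral.integral_add_adjacent_intervals (hI a c) (hI c b),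
    ← intervalIntegral.integral_add_adjacent_intervals (hI c d) (hI d b)]
  refine (norm_add_le _ _).trans ((add_le_add hl1 ((norm_add_le _ _).trans
    (add_le_add hm hl2))).trans (le_of_eq (by ring)))

theorem norm_integral_exp_mul_le_of_le_abs_deriv2 {f f' f'' w w' : ℝ → ℝ} {a b l : ℝ} (hab : a ≤ b)
    (hl : 0 < l)
    (hf : ∀ x, HasDerivAt f (f' x) x) (hf' : ∀ x, HasDerivAt f' (f'' x) x) (hf'' : Continuous f'')
    (hw : ∀ x, HasDerivAt w (w' x) x) (hw' : Continuous w')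
    (h2 : (∀ x ∈ Set.Icc a b, l ≤ f'' x) ∨ (∀ x ∈ Set.Icc a b, l ≤ -f'' x))
    (hw0 : ∀ x ∈ Set.Icc a b, 0 ≤ w x) (hw1 : ∀ x ∈ Set.Icc a b, w x ≤ 1)
    (hwd : ∀ x ∈ Set.Icc a b, w' x ≤ 0) :
    ‖∫ x in a..b, Complex.exp (f x * Complex.I) * w x‖ ≤ 10 / √l := by
  rcases h2 with h2 | h2
  · exact norm_integral_exp_mul_le_of_le_deriv2 hab hl hf hf' hf'' hw hw' h2 hw0 hw1 hwd
  · rw [← norm_integral_exp_neg_mul]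
    exact norm_integral_exp_mul_le_of_le_deriv2 hab hl (fun x ↦ (hf x).neg) (fun x ↦ (hf' x).neg)
      hf''.neg hw hw' h2 hw0 hw1 hwd

/-! ### The dispersion relation and the decay of the kernel -/

theorem hasDerivAt_phi (x : ℝ) : HasDerivAt phi ((1 - x ^ 2) / (1 + x ^ 2) ^ 2) x := by
  have h := (hasDerivAt_id x).div (((hasDerivAt_id x).pow 2).const_add 1)
    (by positivity : (1 : ℝ) + id x ^ 2 ≠ 0)
  refine h.congr_deriv ?_
  simp
  ring

theorem hasDerivAt_deriv_phi (x : ℝ) : HasDerivAt (fun x : ℝ ↦ (1 - x ^ 2) / (1 + x ^ 2) ^ 2)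
    (2 * x * (x ^ 2 - 3) / (1 + x ^ 2) ^ 3) x := by
  have h := (((hasDerivAt_id x).pow 2).const_sub 1).div
    ((((hasDerivAt_id x).pow 2).const_add 1).pow 2)
    (by positivity : ((1 : ℝ) + id x ^ 2) ^ 2 ≠ 0)
  refine h.congr_deriv ?_
  have : (1 : ℝ) + x ^ 2 ≠ 0 := by positivity
  simp
  field_simp
  ring

theorem hasDerivAt_bracket_rpow (s x : ℝ) : HasDerivAt (fun x : ℝ ↦ (1 + x ^ 2) ^ s)
    (2 * x * s * (1 + x ^ 2) ^ (s - 1)) x := by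
  have h := (((hasDerivAt_id x).pow 2).const_add 1).rpow_const (p := s)
    (Or.inl (by positivity : (1 : ℝ) + id x ^ 2 ≠ 0))
  refine h.congr_deriv ?_
  simp

theorem continuous_bracket_rpow (s : ℝ) : Continuous fun x : ℝ ↦ (1 + x ^ 2) ^ s :=
  continuous_iff_continuousAt.2 fun x ↦ (hasDerivAt_bracket_rpow s x).continuousAt

theorem bracket_rpow_le_one {s : ℝ} (hs : s ≤ 0) (x : ℝ) : (1 + x ^ 2) ^ s ≤ 1 :=
  Real.rpow_le_one_of_one_le_of_nonpos (by nlinarith [sq_nonneg x]) hs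

theorem integrable_bracket_rpow {σ : ℝ} (hσ : σ < -1) :
    Integrable fun x : ℝ ↦ (1 + x ^ 2) ^ (σ / 2) := by
  have := integrable_rpow_neg_one_add_norm_sq (E := ℝ) (μ := volume) (r := -σ)
    (by simp; linarith)
  simpa using this

theorem continuous_phi : Continuous phi :=
  continuous_iff_continuousAt.2 fun x ↦ (hasDerivAt_phi x).continuousAt

/-- The integrand of the kernel of `J^σ S(t)`. -/
noncomputable def kernelIntegrand (σ x t η : ℝ) : ℂ :=
  Complex.exp ((x * η - t * phi η : ℝ) * Complex.I) * ((1 + η ^ 2) ^ (σ / 2) : ℝ)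

theorem norm_kernelIntegrand (σ x t η : ℝ) :
    ‖kernelIntegrand σ x t η‖ = (1 + η ^ 2) ^ (σ / 2) := by
  rw [kernelIntegrand, norm_mul, Complex.norm_exp_ofReal_mul_I, one_mul, Complex.norm_real,
    Real.norm_of_nonneg (by positivity)]

theorem continuous_kernelIntegrand (σ x t : ℝ) : Continuous (kernelIntegrand σ x t) := by
  have := continuous_bracket_rpow (σ / 2)
  have := continuous_phi
  unfold kernelIntegrand
  fun_prop

theorem integrable_kernelIntegrand {σ : ℝ} (hσ : σ < -1) (x t : ℝ) :
    Integrable (kernelIntegrand σ x t) :=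
  (integrable_bracket_rpow hσ).mono' (continuous_kernelIntegrand σ x t).aestronglyMeasurable
    (Filter.Eventually.of_forall fun η ↦ (norm_kernelIntegrand σ x t η).le)

theorem norm_integral_kernelIntegrand_le_length {σ : ℝ} (hσ : σ < -1) (x t : ℝ) {a b : ℝ}
    (hab : a ≤ b) : ‖∫ η in a..b, kernelIntegrand σ x t η‖ ≤ b - a := by
  have := intervalIntegral.norm_integral_le_of_norm_le_const (a := a) (b := b) (C := 1)
    (f := kernelIntegrand σ x t) fun η _ ↦ by
      rw [norm_kernelIntegrand]; exact bracket_rpow_le_one (by linarith) η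
  rwa [one_mul, abs_of_nonneg (sub_nonneg.2 hab)] at this

/-- The condition `0 ≤ a` makes the weight `(1 + η²)^{σ/2}` decreasing on the interval, as van der
Corput requires. -/
theorem norm_integral_kernelIntegrand_le {σ : ℝ} (hσ : σ < -1) (x : ℝ) {t a b k : ℝ} (ht : t ≠ 0)
    (ha : 0 ≤ a) (hab : a ≤ b) (hk : 0 < k)
    (h : (∀ η ∈ Set.Icc a b, k ≤ 2 * η * (η ^ 2 - 3) / (1 + η ^ 2) ^ 3) ∨
      (∀ η ∈ Set.Icc a b, k ≤ -(2 * η * (η ^ 2 - 3) / (1 + η ^ 2) ^ 3))) :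
    ‖∫ η in a..b, kernelIntegrand σ x t η‖ ≤ 10 / √(|t| * k) := by
  have ht' := abs_pos.2 ht
  have hc := continuous_bracket_rpow (σ / 2 - 1)
  refine norm_integral_exp_mul_le_of_le_abs_deriv2
    (f' := fun η ↦ x - t * ((1 - η ^ 2) / (1 + η ^ 2) ^ 2))
    (f'' := fun η ↦ -(t * (2 * η * (η ^ 2 - 3) / (1 + η ^ 2) ^ 3)))
    (w' := fun η ↦ 2 * η * (σ / 2) * (1 + η ^ 2) ^ (σ / 2 - 1)) hab (by positivity)
    (fun η ↦ ?_) (fun η ↦ ?_) ?_ (hasDerivAt_bracket_rpow _) (by fun_prop) ?_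
    (fun η _ ↦ by positivity) (fun η _ ↦ bracket_rpow_le_one (by linarith) η) (fun η hη ↦ ?_)
  · refine (((hasDerivAt_id η).const_mul x).sub ((hasDerivAt_phi η).const_mul t)).congr_deriv ?_
    rw [mul_one]
  · simpa using ((hasDerivAt_deriv_phi η).const_mul t).const_sub x
  · refine (continuous_const.mul (Continuous.div (by fun_prop) (by fun_prop) fun η ↦ ?_)).neg
    positivity
  · rcases abs_cases t with ⟨e, _⟩ | ⟨e, _⟩ <;> rw [e] at ht' ⊢ <;> rcases h with h | h
    · exact Or.inr fun η hη ↦ by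
        rw [neg_neg]; exact mul_le_mul_of_nonneg_left (h η hη) ht'.le
    · exact Or.inl fun η hη ↦ by
        rw [← mul_neg]; exact mul_le_mul_of_nonneg_left (h η hη) ht'.le
    · exact Or.inl fun η hη ↦ by
        rw [← neg_mul]; exact mul_le_mul_of_nonneg_left (h η hη) ht'.le
    · exact Or.inr fun η hη ↦ by
        linarith [mul_le_mul_of_nonneg_left (h η hη) ht'.le]
  · have h1 : 0 ≤ η := ha.trans hη.1
    have h2 : 0 ≤ (1 + η ^ 2) ^ (σ / 2 - 1) := by positivity
    exact mul_nonpos_of_nonpos_of_nonneg (by nlinarith) h2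

theorem norm_integral_Ioi_kernelIntegrand_le {σ : ℝ} (hσ : σ < -1) (x t : ℝ) {N : ℝ} (hN : 0 < N) :
    ‖∫ η in Set.Ioi N, kernelIntegrand σ x t η‖ ≤ N ^ (σ + 1) / (-σ - 1) := by
  have h : ‖∫ η in Set.Ioi N, kernelIntegrand σ x t η‖ ≤ ∫ η in Set.Ioi N, η ^ σ := by
    refine norm_integral_le_of_norm_le (integrableOn_Ioi_rpow_of_lt hσ hN) ?_
    filter_upwards [ae_restrict_mem measurableSet_Ioi] with η hη
    have hη0 : 0 < η := hN.trans hη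
    rw [norm_kernelIntegrand]
    calc (1 + η ^ 2) ^ (σ / 2) ≤ (η ^ 2) ^ (σ / 2) :=
          Real.rpow_le_rpow_of_nonpos (by positivity) (by linarith) (by linarith)
      _ = η ^ σ := by
          rw [← Real.rpow_natCast, ← Real.rpow_mul hη0.le]; congr 1; push_cast; ring
  refine h.trans (le_of_eq ?_)
  rw [integral_Ioi_rpow_of_lt hσ hN, ← neg_div_neg_eq, neg_neg]
  congr 1
  ring

/-- From `-2η(η² - 3) = 2η(√3 - η)(√3 + η)`: the concave factor `η(√3 - η)` is smallest at the
endpoints, and the denominator is at most `4³`. -/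
theorem le_deriv2_phi_low {d η : ℝ} (hd0 : 0 < d) (hd : d ≤ 1 / 2)
    (hη : η ∈ Set.Icc d (√3 - d)) : d / 128 ≤ -(2 * η * (η ^ 2 - 3) / (1 + η ^ 2) ^ 3) := by
  have h3 : √3 * √3 = 3 := Real.mul_self_sqrt (by norm_num)
  have h3' : 1.7 ≤ √3 := Real.le_sqrt_of_sq_le (by norm_num)
  obtain ⟨h1, h2⟩ := hη
  have hη0 : 0 < η := hd0.trans_le h1
  rw [← neg_div, le_div_iff₀ (by positivity)]
  have h4 : (1 + η ^ 2) ^ 3 ≤ 4 ^ 3 := by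
    refine pow_le_pow_left₀ (by positivity) ?_ 3
    nlinarith
  have h5 : d ≤ η * (√3 - η) := by nlinarith [mul_nonneg (sub_nonneg.2 h1) (sub_nonneg.2 h2)]
  have h6 : -(2 * η * (η ^ 2 - 3)) = 2 * (η * (√3 - η)) * (√3 + η) := by
    linear_combination (-2 * η) * h3
  rw [h6]
  nlinarith

/-- The numerator is at least `8d` and the denominator at most `10³`. The value `128` rather than
`125` makes the later square roots exact. -/
theorem le_deriv2_phi_mid {d η : ℝ} (hd0 : 0 < d)
    (hη : η ∈ Set.Icc (√3 + d) 3) : d / 128 ≤ 2 * η * (η ^ 2 - 3) / (1 + η ^ 2) ^ 3 := by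
  have h3 : √3 * √3 = 3 := Real.mul_self_sqrt (by norm_num)
  have h3' : 1.7 ≤ √3 := Real.le_sqrt_of_sq_le (by norm_num)
  obtain ⟨h1, h2⟩ := hη
  have hη0 : 1.7 < η := by linarith
  rw [le_div_iff₀ (by positivity)]
  have h4 : (1 + η ^ 2) ^ 3 ≤ 10 ^ 3 := by
    refine pow_le_pow_left₀ (by positivity) ?_ 3
    nlinarith
  have h6 : 2 * η * (η ^ 2 - 3) = (η - √3) * (2 * η * (√3 + η)) := by
    linear_combination (2 * η) * h3
  have h7 : 8 ≤ 2 * η * (√3 + η) := by nlinarith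
  rw [h6]
  nlinarith

theorem le_deriv2_phi_high {N η : ℝ} (hη : η ∈ Set.Icc 3 N) :
    27 / 64 / N ^ 3 ≤ 2 * η * (η ^ 2 - 3) / (1 + η ^ 2) ^ 3 := by
  obtain ⟨h1, h2⟩ := hη
  have hη0 : 0 < η := by linarith
  have h3 : 27 / 64 / N ^ 3 ≤ 27 / 64 / η ^ 3 :=
    div_le_div_of_nonneg_left (by norm_num) (by positivity) (pow_le_pow_left₀ hη0.le h2 3)
  refine h3.trans ?_
  rw [div_le_div_iff₀ (by positivity) (by positivity)]
  have h4 : (1 + η ^ 2) ^ 3 ≤ (10 / 9 * η ^ 2) ^ 3 := by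
    refine pow_le_pow_left₀ (by positivity) ?_ 3
    nlinarith
  have h5 : 2 / 3 * η ^ 2 ≤ η ^ 2 - 3 := by nlinarith
  have h6 : 2 * η * (2 / 3 * η ^ 2) * η ^ 3 ≤ 2 * η * (η ^ 2 - 3) * η ^ 3 := by gcongr
  have h7 : 0 ≤ η ^ 6 := by positivity
  nlinarith

/-- This and `div_le_beta` absorb the two decay rates for `|t| ≥ 1`. The quantity `(σ + 1) / (1 -
2σ)` is at least `-1/3` exactly when `σ ≥ -4`; below `-4`, `-3 / (1 - 2σ)` exceeds both rates. -/
theorem neg_third_le_beta {σ : ℝ} (hσ : σ < -1) : -1 / 3 ≤ beta σ := by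
  unfold beta
  split_ifs with h
  · rw [div_le_div_iff₀ (by norm_num) (by linarith)]; linarith
  · rw [div_le_div_iff₀ (by norm_num) (by linarith)]; linarith

theorem div_le_beta (σ : ℝ) : (σ + 1) / (1 - 2 * σ) ≤ beta σ := by
  unfold beta
  split_ifs with h
  · exact le_rfl
  · exact div_le_div_of_nonneg_right (by linarith) (by linarith)

theorem beta_nonpos {σ : ℝ} (hσ : σ < -1) : beta σ ≤ 0 := by
  unfold beta
  split_ifs with h
  · exact div_nonpos_of_nonpos_of_nonneg (by linarith) (by linarith)
  · exact div_nonpos_of_nonpos_of_nonneg (by linarith) (by linarith)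

/-- The half-line is cut at `d`, `√3 - d`, `√3 + d`, `3` and `N`. The two pieces at the zeros of
`φ''` are bounded by their length, the tail by absolute values, and the other three by van der
Corput. -/
theorem norm_integral_Ioi_zero_kernelIntegrand_le {σ : ℝ} (hσ : σ < -1) (x : ℝ) {t : ℝ}
    (ht : 1 ≤ |t|) :
    ‖∫ η in Set.Ioi 0, kernelIntegrand σ x t η‖ ≤ (402 + 1 / (-σ - 1)) * |t| ^ beta σ := by
  have ht0 : t ≠ 0 := by rintro rfl; norm_num at ht
  set T := |t| with hT
  have hT0 : 0 < T := by linarith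
  set a := 1 / (1 - 2 * σ) with ha
  have h12 : 0 < 1 - 2 * σ := by linarith
  have ha0 : 0 < a := by positivity
  -- This size balances the length `d` against `(T d)^{-1/2}`; the factor `1/2` keeps `d ≤ 1/2`.
  set d := T ^ (-1 / 3 : ℝ) / 2 with hd
  have hp1 : T ^ (-1 / 3 : ℝ) ≤ T ^ beta σ :=
    Real.rpow_le_rpow_of_exponent_le ht (neg_third_le_beta hσ)
  have hp2 : T ^ ((σ + 1) / (1 - 2 * σ)) ≤ T ^ beta σ :=
    Real.rpow_le_rpow_of_exponent_le ht (div_le_beta σ)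
  have hd0 : 0 < d := by positivity
  have hd1 : d ≤ 1 / 2 := by
    have := Real.rpow_le_one_of_one_le_of_nonpos ht (by norm_num : (-1 / 3 : ℝ) ≤ 0)
    rw [hd]; linarith
  have h3' : 1.7 ≤ √3 := Real.le_sqrt_of_sq_le (by norm_num)
  have h3'' : √3 ≤ 1.8 := Real.sqrt_le_iff.2 (by norm_num)
  -- The exponent `a` balances `T^{-1/2} N^{3/2}` against `N^{σ+1}`; the factor `3` ensures `3 ≤ N`.
  set N := 3 * T ^ a with hN
  have hN3 : 3 ≤ N := by
    have := Real.one_le_rpow ht ha0.le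
    rw [hN]; linarith
  have hs1 : 10 / √(T * (d / 128)) = 160 * T ^ (-1 / 3 : ℝ) := by
    have : T * (d / 128) = (T ^ (1 / 3 : ℝ) / 16) ^ 2 := by
      have e : T * T ^ (-1 / 3 : ℝ) = T ^ (1 / 3 : ℝ) * T ^ (1 / 3 : ℝ) := by
        rw [← Real.rpow_one_add' hT0.le (by norm_num), ← Real.rpow_add hT0]; norm_num
      rw [hd]
      linear_combination e / 256
    rw [this, Real.sqrt_sq (by positivity), neg_div, Real.rpow_neg hT0.le]
    field_simp
    norm_num
  have hs2 : 10 / √(T * (27 / 64 / N ^ 3)) = 80 * T ^ ((σ + 1) / (1 - 2 * σ)) := by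
    have : T * (27 / 64 / N ^ 3) = ((T ^ ((σ + 1) / (1 - 2 * σ)))⁻¹ / 8) ^ 2 := by
      have e : T * (T ^ ((σ + 1) / (1 - 2 * σ))) ^ 2 = (T ^ a) ^ 3 := by
        rw [← Real.rpow_natCast, ← Real.rpow_natCast, ← Real.rpow_mul hT0.le,
          ← Real.rpow_mul hT0.le]
        nth_rw 1 [← Real.rpow_one T]
        rw [← Real.rpow_add hT0]
        congr 1
        rw [ha]
        push_cast
        rw [eq_comm, div_mul_eq_mul_div, div_mul_eq_mul_div, div_eq_iff h12.ne', add_mul,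
          div_mul_cancel₀ _ h12.ne']
        ring
      rw [hN, mul_pow, ← e]
      field_simp
      norm_num
    rw [this, Real.sqrt_sq (by positivity)]
    field_simp
    norm_num
  have hI : Integrable (kernelIntegrand σ x t) := integrable_kernelIntegrand hσ x t
  have hii : ∀ u v, IntervalIntegrable (kernelIntegrand σ x t) volume u v := fun u v ↦
    hI.intervalIntegrable
  have b1 := norm_integral_kernelIntegrand_le_length hσ x t hd0.le
  have b2 := norm_integral_kernelIntegrand_le hσ x ht0 hd0.le (b := √3 - d) (by linarith)
    (by positivity : 0 < d / 128) (Or.inr fun η hη ↦ le_deriv2_phi_low hd0 hd1 hη)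
  have b3 := norm_integral_kernelIntegrand_le_length hσ x t (a := √3 - d) (b := √3 + d)
    (by linarith)
  have b4 := norm_integral_kernelIntegrand_le hσ x ht0 (a := √3 + d) (b := 3) (by linarith)
    (by linarith) (by positivity : 0 < d / 128) (Or.inl fun η hη ↦ le_deriv2_phi_mid hd0 hη)
  have b5 := norm_integral_kernelIntegrand_le hσ x ht0 (a := 3) (b := N) (by linarith) hN3
    (by positivity : 0 < 27 / 64 / N ^ 3) (Or.inl fun η hη ↦ le_deriv2_phi_high hη)
  have b6 := norm_integral_Ioi_kernelIntegrand_le hσ x t (N := N) (by linarith)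
  rw [← hT, hs1] at b2 b4
  rw [← hT, hs2] at b5
  have b6' : N ^ (σ + 1) / (-σ - 1) ≤ 1 / (-σ - 1) * T ^ ((σ + 1) / (1 - 2 * σ)) := by
    rw [div_mul_eq_mul_div, one_mul]
    refine div_le_div_of_nonneg_right ?_ (by linarith)
    calc N ^ (σ + 1) ≤ (T ^ a) ^ (σ + 1) := by
          refine Real.rpow_le_rpow_of_nonpos (by positivity) ?_ (by linarith)
          rw [hN]; linarith [Real.rpow_pos_of_pos hT0 a]
      _ = T ^ ((σ + 1) / (1 - 2 * σ)) := by
          rw [← Real.rpow_mul hT0.le]; congr 1; rw [ha]; ring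
  have b := norm_add₃_le (a := ∫ η in (0)..d, kernelIntegrand σ x t η)
    (b := ∫ η in d..(√3 - d), kernelIntegrand σ x t η)
    (c := ∫ η in (√3 - d)..(√3 + d), kernelIntegrand σ x t η)
  have b' := norm_add₃_le (a := ∫ η in (√3 + d)..3, kernelIntegrand σ x t η)
    (b := ∫ η in (3)..N, kernelIntegrand σ x t η)
    (c := ∫ η in Set.Ioi N, kernelIntegrand σ x t η)
  rw [intervalIntegral.integral_add_adjacent_intervals (hii _ _) (hii _ _),
    intervalIntegral.integral_add_adjacent_intervals (hii _ _) (hii _ _)] at b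
  rw [intervalIntegral.integral_add_adjacent_intervals (hii _ _) (hii _ _),
    intervalIntegral.integral_interval_add_Ioi' (hii _ _) hI.integrableOn] at b'
  have hsum := norm_add_le (∫ η in (0)..(√3 + d), kernelIntegrand σ x t η)
    (∫ η in Set.Ioi (√3 + d), kernelIntegrand σ x t η)
  rw [intervalIntegral.integral_interval_add_Ioi' (hii _ _) hI.integrableOn] at hsum
  have hq : 1 / (-σ - 1) * T ^ ((σ + 1) / (1 - 2 * σ)) ≤ 1 / (-σ - 1) * T ^ beta σ :=
    mul_le_mul_of_nonneg_left hp2 (one_div_nonneg.2 (by linarith))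
  -- The lengths `d + 2d` contribute `3/2`, the van der Corput pieces `160 + 160 + 80`, which
  -- together stay below `402`.
  have hdp : 2 * d = T ^ (-1 / 3 : ℝ) := by rw [hd]; ring
  linarith [Real.rpow_pos_of_pos hT0 (beta σ)]

/-- Since `φ` is odd, negative frequencies reduce to positive ones with `x` and `t` reversed. -/
theorem kernelIntegrand_neg (σ x t η : ℝ) :
    kernelIntegrand σ x t (-η) = kernelIntegrand σ (-x) (-t) η := by
  simp only [kernelIntegrand, phi, neg_sq, neg_div, mul_neg, neg_mul]

/-- Decay of the kernel of `J^σ S(t)`. -/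
theorem exists_norm_integral_kernelIntegrand_le {σ : ℝ} (hσ : σ < -1) :
    ∃ C : ℝ, 0 < C ∧ ∀ x t : ℝ, t ≠ 0 →
      ‖∫ η, kernelIntegrand σ x t η‖ ≤ C * |t| ^ beta σ := by
  set W := ∫ η : ℝ, (1 + η ^ 2) ^ (σ / 2) with hW
  have hW0 : 0 ≤ W := integral_nonneg fun η ↦ by positivity
  have hs : 0 < 1 / (-σ - 1) := one_div_pos.2 (by linarith)
  refine ⟨2 * (402 + 1 / (-σ - 1)) + W, by positivity, fun x t ht ↦ ?_⟩
  have hb : 0 < |t| ^ beta σ := Real.rpow_pos_of_pos (abs_pos.2 ht) _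
  rcases le_or_gt 1 |t| with h1 | h1
  · have hI := integrable_kernelIntegrand hσ x t
    rw [← intervalIntegral.integral_Iic_add_Ioi (b := 0) hI.integrableOn hI.integrableOn]
    have e : ∫ η in Set.Iic 0, kernelIntegrand σ x t η =
        ∫ η in Set.Ioi 0, kernelIntegrand σ (-x) (-t) η := by
      simp_rw [← kernelIntegrand_neg]
      rw [integral_comp_neg_Ioi, neg_zero]
    rw [e]
    have i1 := norm_integral_Ioi_zero_kernelIntegrand_le hσ (-x) (t := -t) (by rwa [abs_neg])
    have i2 := norm_integral_Ioi_zero_kernelIntegrand_le hσ x h1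
    rw [abs_neg] at i1
    refine (norm_add_le _ _).trans ((add_le_add i1 i2).trans ?_)
    nlinarith [mul_nonneg hW0 hb.le]
  · have i1 : ‖∫ η, kernelIntegrand σ x t η‖ ≤ W := by
      refine (norm_integral_le_integral_norm _).trans (le_of_eq ?_)
      simp_rw [norm_kernelIntegrand, hW]
    have i2 : 1 ≤ |t| ^ beta σ :=
      Real.one_le_rpow_of_pos_of_le_one_of_nonpos (abs_pos.2 ht) h1.le (beta_nonpos hσ)
    nlinarith

/-! ### Riesz–Thorin interpolation for bilinear forms -/

section Interpolation

variable {α : Type*} [MeasurableSpace α] {μ : Measure α}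

/-- `B` is bilinear on integrable functions. -/
structure IsBilinearOnL1 (μ : Measure α) (B : (α → ℂ) → (α → ℂ) → ℂ) : Prop where
  add_left : ∀ f₁ f₂ g, Integrable f₁ μ → Integrable f₂ μ → Integrable g μ →
    B (f₁ + f₂) g = B f₁ g + B f₂ g
  smul_left : ∀ (c : ℂ) f g, B (c • f) g = c * B f g
  add_right : ∀ f g₁ g₂, Integrable f μ → Integrable g₁ μ → Integrable g₂ μ →
    B f (g₁ + g₂) = B f g₁ + B f g₂
  smul_right : ∀ (c : ℂ) f g, B f (c • g) = c * B f g

namespace IsBilinearOnL1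

variable {B : (α → ℂ) → (α → ℂ) → ℂ}

theorem sum_left (hB : IsBilinearOnL1 μ B) {ι : Type*} (s : Finset ι) (c : ι → ℂ)
    (F : ι → α → ℂ) (g : α → ℂ) (hF : ∀ i ∈ s, Integrable (F i) μ) (hg : Integrable g μ) :
    B (∑ i ∈ s, c i • F i) g = ∑ i ∈ s, c i * B (F i) g := by
  classical
  induction s using Finset.induction_on with
  | empty => simpa using hB.smul_left 0 0 g
  | insert i s hi ih =>
    rw [Finset.sum_insert hi, Finset.sum_insert hi, hB.add_left, hB.smul_left, ih]
    · exact fun j hj ↦ hF j (Finset.mem_insert_of_mem hj)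
    · exact (hF i (Finset.mem_insert_self i s)).smul (c i)
    · exact integrable_finsetSum' s fun j hj ↦ (hF j (Finset.mem_insert_of_mem hj)).smul (c j)
    · exact hg

theorem sum_right (hB : IsBilinearOnL1 μ B) {ι : Type*} (s : Finset ι) (c : ι → ℂ)
    (f : α → ℂ) (G : ι → α → ℂ) (hf : Integrable f μ) (hG : ∀ i ∈ s, Integrable (G i) μ) :
    B f (∑ i ∈ s, c i • G i) = ∑ i ∈ s, c i * B f (G i) :=
  sum_left (B := fun g f ↦ B f g)
    ⟨fun f₁ f₂ g h₁ h₂ h ↦ hB.add_right g f₁ f₂ h h₁ h₂, fun c f g ↦ hB.smul_right c g f,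
      fun f g₁ g₂ h h₁ h₂ ↦ hB.add_left g₁ g₂ f h₁ h₂ h, fun c f g ↦ hB.smul_left c g f⟩
    s c G f hG hf

theorem sub_left (hB : IsBilinearOnL1 μ B) {f₁ f₂ g : α → ℂ} (h₁ : Integrable f₁ μ)
    (h₂ : Integrable f₂ μ) (hg : Integrable g μ) : B (f₁ - f₂) g = B f₁ g - B f₂ g := by
  rw [sub_eq_add_neg, ← neg_one_smul ℂ f₂, hB.add_left _ _ _ h₁ (h₂.smul _) hg, hB.smul_left]
  ring

theorem sub_right (hB : IsBilinearOnL1 μ B) {f g₁ g₂ : α → ℂ} (hf : Integrable f μ)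
    (h₁ : Integrable g₁ μ) (h₂ : Integrable g₂ μ) : B f (g₁ - g₂) = B f g₁ - B f g₂ := by
  rw [sub_eq_add_neg, ← neg_one_smul ℂ g₂, hB.add_right _ _ _ hf h₁ (h₂.smul _), hB.smul_right]
  ring

end IsBilinearOnL1

/-- The analytic family `c |c| ^ (q (1 - z / 2) - 1)` through `c`. -/
noncomputable def powerFamily (q : ℝ) (c z : ℂ) : ℂ :=
  c / ‖c‖ * (‖c‖ : ℂ) ^ (q * (1 - z / 2))

theorem powerFamily_zero (q : ℝ) (z : ℂ) : powerFamily q 0 z = 0 := by simp [powerFamily]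

/-- The modulus depends only on `Re z`: it is `|c|^q` on `Re z = 0` and `|c|^{q/2}` on `Re z = 1`,
which turns the `L¹` and `L²` norms at the two edges into powers of `∫ |f|^q`. -/
theorem norm_powerFamily {q : ℝ} (hq : 0 < q) (c : ℂ) {z : ℂ} (hz : z.re ≤ 1) :
    ‖powerFamily q c z‖ = ‖c‖ ^ (q * (1 - z.re / 2)) := by
  rcases eq_or_ne c 0 with rfl | hc
  · rw [powerFamily_zero, norm_zero, Real.zero_rpow]
    exact (mul_pos hq (by linarith)).ne'
  · have h : 0 < ‖c‖ := norm_pos_iff.2 hc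
    rw [powerFamily, norm_mul, norm_div, Complex.norm_real, norm_norm, div_self h.ne', one_mul,
      Complex.norm_cpow_eq_rpow_re_of_pos h]
    congr 1
    simp

theorem powerFamily_eq_self {q θ : ℝ} (h : q * (1 - θ / 2) = 1) (c : ℂ) :
    powerFamily q c θ = c := by
  rcases eq_or_ne c 0 with rfl | hc
  · exact powerFamily_zero q _
  · have h1 : (‖c‖ : ℂ) ≠ 0 := by simpa using hc
    have h2 : (q : ℂ) * (1 - θ / 2) = 1 := by exact_mod_cast h
    rw [powerFamily, h2, Complex.cpow_one, div_mul_cancel₀ _ h1]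

theorem differentiable_powerFamily (q : ℝ) (c : ℂ) : Differentiable ℂ (powerFamily q c) := by
  rcases eq_or_ne c 0 with rfl | hc
  · have : powerFamily q 0 = fun _ ↦ 0 := funext (powerFamily_zero q)
    rw [this]; exact differentiable_const 0
  · have h1 : (‖c‖ : ℂ) ≠ 0 := by simpa using hc
    refine (differentiable_const _).mul fun z ↦ ?_
    exact DifferentiableAt.const_cpow (by fun_prop) (Or.inl h1)

theorem norm_powerFamily_le {q : ℝ} (hq : 0 < q) (c : ℂ) {z : ℂ} (h0 : 0 ≤ z.re)
    (h1 : z.re ≤ 1) : ‖powerFamily q c z‖ ≤ (1 + ‖c‖) ^ q := by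
  rw [norm_powerFamily hq c h1]
  have : 0 ≤ ‖c‖ := norm_nonneg c
  calc ‖c‖ ^ (q * (1 - z.re / 2)) ≤ (1 + ‖c‖) ^ (q * (1 - z.re / 2)) :=
        Real.rpow_le_rpow this (by linarith) (mul_nonneg hq.le (by linarith))
    _ ≤ (1 + ‖c‖) ^ q := Real.rpow_le_rpow_of_exponent_le (by linarith) (by nlinarith)

/-- The value `0` is left out because its fibre may have infinite measure, so that its indicator
need not be integrable. -/
theorem comp_simpleFunc_eq_sum (f : SimpleFunc α ℂ) (h : ℂ → ℂ) (h0 : h 0 = 0) :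
    (fun x ↦ h (f x)) =
      ∑ c ∈ f.range.filter (· ≠ 0), h c • (f ⁻¹' {c}).indicator fun _ ↦ (1 : ℂ) := by
  classical
  funext x
  rw [Finset.sum_apply]
  by_cases hx : f x = 0
  · rw [hx, h0, Finset.sum_eq_zero]
    intro c hc
    have : x ∉ f ⁻¹' {c} := fun hxc ↦ (Finset.mem_filter.1 hc).2 (by
      rw [← hx]; exact (Set.mem_singleton_iff.1 hxc).symm)
    simp [this]
  · rw [Finset.sum_eq_single (f x)]
    · simp
    · intro c _ hc
      have : x ∉ f ⁻¹' {c} := fun hxc ↦ hc (Set.mem_singleton_iff.1 hxc).symm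
      simp [this]
    · intro h
      exact absurd (Finset.mem_filter.2 ⟨f.mem_range_self x, hx⟩) h

variable {B : (α → ℂ) → (α → ℂ) → ℂ} {A q θ : ℝ}

/-- Riesz–Thorin interpolation between `L¹ × L¹` and `L² × L²`, for simple functions. -/
theorem norm_bilinear_le_of_simpleFunc (hB : IsBilinearOnL1 μ B) (hA : 0 ≤ A)
    (h1 : ∀ f g, Integrable f μ → Integrable g μ → ‖B f g‖ ≤ A * ((∫ x, ‖f x‖ ∂μ) * ∫ x, ‖g x‖ ∂μ))
    (h2 : ∀ f g, Integrable f μ → Integrable g μ → MemLp f 2 μ → MemLp g 2 μ →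
      ‖B f g‖ ≤ (∫ x, ‖f x‖ ^ (2 : ℝ) ∂μ) ^ (1 / 2 : ℝ) * (∫ x, ‖g x‖ ^ (2 : ℝ) ∂μ) ^ (1 / 2 : ℝ))
    (hq : 0 < q) (hθ0 : 0 ≤ θ) (hθ1 : θ ≤ 1) (hqθ : q * (1 - θ / 2) = 1)
    (f g : SimpleFunc α ℂ) (hf : Integrable f μ) (hg : Integrable g μ) :
    ‖B f g‖ ≤ A ^ (1 - θ) * ((∫ x, ‖f x‖ ^ q ∂μ) ^ (1 / q) * (∫ x, ‖g x‖ ^ q ∂μ) ^ (1 / q)) := by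
  have hind : ∀ (f : SimpleFunc α ℂ), Integrable f μ → ∀ c ∈ f.range.filter (· ≠ 0),
      Integrable ((f ⁻¹' {c}).indicator fun _ ↦ (1 : ℂ)) μ := fun f hf c hc ↦
    (integrable_indicator_iff (f.measurableSet_fiber c)).2 (integrableOn_const
      (SimpleFunc.integrable_iff.1 hf c (Finset.mem_filter.1 hc).2).ne)
  -- `F` is the form evaluated at the analytic families through `f` and `g`, expanded over level
  -- sets: a finite sum, hence entire and bounded on the strip. Hadamard's three lines theorem
  -- applies, and `F θ = B f g`.
  set F : ℂ → ℂ := fun z ↦ ∑ c ∈ f.range.filter (· ≠ 0), powerFamily q c z *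
    ∑ d ∈ g.range.filter (· ≠ 0), powerFamily q d z *
      B ((f ⁻¹' {c}).indicator fun _ ↦ (1 : ℂ)) ((g ⁻¹' {d}).indicator fun _ ↦ (1 : ℂ)) with hF
  have hInt : ∀ (f : SimpleFunc α ℂ), Integrable f μ → ∀ z,
      Integrable (fun x ↦ powerFamily q (f x) z) μ ∧ MemLp (fun x ↦ powerFamily q (f x) z) 2 μ := by
    intro f hf z
    have h : (f.map fun c ↦ powerFamily q c z).FinMeasSupp μ :=
      (SimpleFunc.integrable_iff_finMeasSupp.1 hf).map (powerFamily_zero q z)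
    exact ⟨h.integrable, (SimpleFunc.memLp_iff_finMeasSupp two_ne_zero ENNReal.ofNat_ne_top).2 h⟩
  have hFB : ∀ z, F z = B (fun x ↦ powerFamily q (f x) z) (fun x ↦ powerFamily q (g x) z) := by
    intro z
    rw [comp_simpleFunc_eq_sum f (fun c ↦ powerFamily q c z) (powerFamily_zero q z),
      hB.sum_left _ _ _ _ (hind f hf) (hInt g hg z).1]
    refine Finset.sum_congr rfl fun c hc ↦ ?_
    rw [comp_simpleFunc_eq_sum g (fun c ↦ powerFamily q c z) (powerFamily_zero q z),
      hB.sum_right _ _ _ _ (hind f hf c hc) (hind g hg)]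
  have hdiff : Differentiable ℂ F := by
    have := differentiable_powerFamily q
    simp only [hF]
    fun_prop
  have hbdd : BddAbove ((norm ∘ F) '' Complex.HadamardThreeLines.verticalClosedStrip 0 1) := by
    refine ⟨∑ c ∈ f.range.filter (· ≠ 0), (1 + ‖c‖) ^ q *
      ∑ d ∈ g.range.filter (· ≠ 0), (1 + ‖d‖) ^ q *
      ‖B ((f ⁻¹' {c}).indicator fun _ ↦ (1 : ℂ)) ((g ⁻¹' {d}).indicator fun _ ↦ (1 : ℂ))‖, ?_⟩
    rintro _ ⟨z, ⟨hz0, hz1⟩, rfl⟩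
    refine (norm_sum_le _ _).trans (Finset.sum_le_sum fun c _ ↦ ?_)
    rw [norm_mul]
    refine mul_le_mul (norm_powerFamily_le hq c hz0 hz1) ?_ (norm_nonneg _) (by positivity)
    refine (norm_sum_le _ _).trans (Finset.sum_le_sum fun d _ ↦ ?_)
    rw [norm_mul]
    exact mul_le_mul_of_nonneg_right (norm_powerFamily_le hq d hz0 hz1) (norm_nonneg _)
  set Nf := ∫ x, ‖f x‖ ^ q ∂μ with hNf
  set Ng := ∫ x, ‖g x‖ ^ q ∂μ with hNg
  have hNf0 : 0 ≤ Nf := integral_nonneg fun x ↦ by positivity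
  have hNg0 : 0 ≤ Ng := integral_nonneg fun x ↦ by positivity
  have ha : ∀ z ∈ Complex.re ⁻¹' {0}, ‖F z‖ ≤ A * (Nf * Ng) := by
    intro z hz
    have hz : z.re = 0 := hz
    rw [hFB]
    refine (h1 _ _ (hInt f hf z).1 (hInt g hg z).1).trans (le_of_eq ?_)
    simp_rw [norm_powerFamily hq _ (show z.re ≤ 1 by linarith), hz, hNf, hNg]
    norm_num
  have hb : ∀ z ∈ Complex.re ⁻¹' {1}, ‖F z‖ ≤ Nf ^ (1 / 2 : ℝ) * Ng ^ (1 / 2 : ℝ) := by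
    intro z hz
    have hz : z.re = 1 := hz
    rw [hFB]
    refine (h2 _ _ (hInt f hf z).1 (hInt g hg z).1 (hInt f hf z).2 (hInt g hg z).2).trans
      (le_of_eq ?_)
    simp_rw [norm_powerFamily hq _ hz.le, hz, ← Real.rpow_mul (norm_nonneg _),
      show q * (1 - 1 / 2) * 2 = q by ring, hNf, hNg]
  have key := Complex.HadamardThreeLines.norm_le_interp_of_mem_verticalClosedStrip₀₁' F
    (z := (θ : ℂ)) ⟨by simpa using hθ0, by simpa using hθ1⟩ hdiff.diffContOnCl hbdd ha hb
  rw [hFB] at key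
  simp_rw [powerFamily_eq_self hqθ, Complex.ofReal_re] at key
  refine key.trans (le_of_eq ?_)
  have hq1 : 1 / q = (1 - θ) + 1 / 2 * θ := by
    field_simp; linarith
  have hpos : (1 - θ) + 1 / 2 * θ ≠ 0 := by
    rw [← hq1]; positivity
  rw [hq1, Real.mul_rpow hA (mul_nonneg hNf0 hNg0), Real.mul_rpow hNf0 hNg0,
    Real.mul_rpow (by positivity) (by positivity), ← Real.rpow_mul hNf0, ← Real.rpow_mul hNg0,
    Real.rpow_add' hNf0 hpos, Real.rpow_add' hNg0 hpos]
  ring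

/-- Riesz–Thorin interpolation between `L¹ × L¹` and `L² × L²`. -/
theorem norm_bilinear_le (hB : IsBilinearOnL1 μ B) (hA : 0 ≤ A)
    (h1 : ∀ f g, Integrable f μ → Integrable g μ → ‖B f g‖ ≤ A * ((∫ x, ‖f x‖ ∂μ) * ∫ x, ‖g x‖ ∂μ))
    (h2 : ∀ f g, Integrable f μ → Integrable g μ → MemLp f 2 μ → MemLp g 2 μ →
      ‖B f g‖ ≤ (∫ x, ‖f x‖ ^ (2 : ℝ) ∂μ) ^ (1 / 2 : ℝ) * (∫ x, ‖g x‖ ^ (2 : ℝ) ∂μ) ^ (1 / 2 : ℝ))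
    (hθ0 : 0 ≤ θ) (hθ1 : θ ≤ 1) {q : ℝ≥0∞} (hq1 : 1 ≤ q) (hqtop : q ≠ ∞)
    (hqθ : q.toReal * (1 - θ / 2) = 1)
    {f g : α → ℂ} (hfm : Measurable f) (hgm : Measurable g) (hf : Integrable f μ)
    (hg : Integrable g μ) (hfq : MemLp f q μ) (hgq : MemLp g q μ) :
    ‖B f g‖ ≤ A ^ (1 - θ) * ((eLpNorm f q μ).toReal * (eLpNorm g q μ).toReal) := by
  have hq0 : q ≠ 0 := (zero_lt_one.trans_le hq1).ne'
  have hqr : 0 < q.toReal := ENNReal.toReal_pos hq0 hqtop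
  -- The same simple functions converge in `L¹` and in `L^q`: the former passes to the limit in `B`
  -- through `h1`, the latter in the right-hand side.
  have happrox : ∀ {f : α → ℂ}, Measurable f → Integrable f μ → MemLp f q μ →
      ∃ u : ℕ → SimpleFunc α ℂ, (∀ n, Integrable (u n) μ) ∧
        Filter.Tendsto (fun n ↦ ∫ x, ‖(u n - f : α → ℂ) x‖ ∂μ) Filter.atTop (nhds 0) ∧
        Filter.Tendsto (fun n ↦ (eLpNorm (u n - f : α → ℂ) q μ).toReal) Filter.atTop (nhds 0) := by
    intro f hfm hf hfq
    have hu : ∀ n, Integrable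
        (SimpleFunc.approxOn f hfm (Set.range f ∪ {0}) 0 (by simp) n) μ := fun n ↦
      SimpleFunc.integrable_approxOn_range hfm hf n
    refine ⟨fun n ↦ SimpleFunc.approxOn f hfm (Set.range f ∪ {0}) 0 (by simp) n, hu, ?_, ?_⟩
    · have := SimpleFunc.tendsto_approxOn_range_Lp_eLpNorm (p := 1) ENNReal.one_ne_top hfm
        (memLp_one_iff_integrable.2 hf).2
      have := (ENNReal.tendsto_toReal ENNReal.zero_ne_top).comp this
      refine this.congr fun n ↦ ?_
      rw [Function.comp_apply, eLpNorm_one_eq_lintegral_enorm,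
        integral_norm_eq_lintegral_enorm ((hu n).sub hf).aestronglyMeasurable]
    · exact (ENNReal.tendsto_toReal ENNReal.zero_ne_top).comp
        (SimpleFunc.tendsto_approxOn_range_Lp_eLpNorm hqtop hfm hfq.2)
  obtain ⟨u, hu, hu1, huq⟩ := happrox hfm hf hfq
  obtain ⟨v, hv, hv1, hvq⟩ := happrox hgm hg hgq
  have hmem : ∀ (f : SimpleFunc α ℂ), Integrable f μ → MemLp f q μ := fun f hf ↦
    (SimpleFunc.memLp_iff_integrable hq0 hqtop).2 hf
  have hnorm : ∀ (f : SimpleFunc α ℂ), Integrable f μ →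
      (∫ x, ‖f x‖ ^ q.toReal ∂μ) ^ (1 / q.toReal) = (eLpNorm f q μ).toReal := fun f hf ↦ by
    rw [(hmem f hf).eLpNorm_eq_integral_rpow_norm hq0 hqtop, ENNReal.toReal_ofReal, one_div]
    exact Real.rpow_nonneg (integral_nonneg fun x ↦ by positivity) _
  have htri : ∀ (u : SimpleFunc α ℂ) (f : α → ℂ), Integrable u μ → MemLp f q μ →
      (eLpNorm u q μ).toReal ≤ (eLpNorm (u - f : α → ℂ) q μ).toReal + (eLpNorm f q μ).toReal := by
    intro u f hu hf
    have hs := (hmem u hu).sub hf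
    rw [← ENNReal.toReal_add hs.2.ne hf.2.ne]
    refine ENNReal.toReal_mono (ENNReal.add_ne_top.2 ⟨hs.2.ne, hf.2.ne⟩) ?_
    simpa using eLpNorm_add_le hs.1 hf.1 hq1
  have hlim : Filter.Tendsto (fun n ↦ B (u n) (v n)) Filter.atTop (nhds (B f g)) := by
    rw [tendsto_iff_norm_sub_tendsto_zero]
    have hb : ∀ n, ‖B (u n) (v n) - B f g‖ ≤
        A * ((∫ x, ‖(u n - f : α → ℂ) x‖ ∂μ) * ((∫ x, ‖(v n - g : α → ℂ) x‖ ∂μ))) +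
        A * ((∫ x, ‖(u n - f : α → ℂ) x‖ ∂μ) * ∫ x, ‖g x‖ ∂μ) +
        A * ((∫ x, ‖f x‖ ∂μ) * ∫ x, ‖(v n - g : α → ℂ) x‖ ∂μ) := by
      intro n
      have e : B (u n) (v n) - B f g =
          B (u n - f) (v n - g) + B (u n - f) g + B f (v n - g) := by
        rw [hB.sub_left (hu n) hf ((hv n).sub hg), hB.sub_right (hu n) (hv n) hg,
          hB.sub_right hf (hv n) hg, hB.sub_left (hu n) hf hg]
        ring
      rw [e]
      exact norm_add₃_le.trans (add_le_add (add_le_add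
        (h1 _ _ ((hu n).sub hf) ((hv n).sub hg)) (h1 _ _ ((hu n).sub hf) hg))
        (h1 _ _ hf ((hv n).sub hg)))
    refine squeeze_zero (fun n ↦ norm_nonneg _) hb ?_
    have := (((hu1.mul hv1).const_mul A).add ((hu1.mul_const (∫ x, ‖g x‖ ∂μ)).const_mul A)).add
      ((hv1.const_mul (∫ x, ‖f x‖ ∂μ)).const_mul A)
    simpa using this
  have hrhs : Filter.Tendsto (fun n ↦ A ^ (1 - θ) *
      (((eLpNorm (u n - f : α → ℂ) q μ).toReal + (eLpNorm f q μ).toReal) *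
      ((eLpNorm (v n - g : α → ℂ) q μ).toReal + (eLpNorm g q μ).toReal))) Filter.atTop
      (nhds (A ^ (1 - θ) * ((eLpNorm f q μ).toReal * (eLpNorm g q μ).toReal))) := by
    have := ((huq.add_const (eLpNorm f q μ).toReal).mul
      (hvq.add_const (eLpNorm g q μ).toReal)).const_mul (A ^ (1 - θ))
    simpa using this
  refine le_of_tendsto_of_tendsto' hlim.norm hrhs fun n ↦ ?_
  have := norm_bilinear_le_of_simpleFunc hB hA h1 h2 hqr hθ0 hθ1 hqθ (u n) (v n) (hu n) (hv n)
  rw [hnorm _ (hu n), hnorm _ (hv n)] at this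
  refine this.trans ?_
  gcongr
  · exact htri _ _ (hu n) hfq
  · exact htri _ _ (hv n) hgq

end Interpolation

/-! ### Fourier transform on `L¹` and `L¹ ∩ L²` -/

open scoped FourierTransform

theorem continuous_fourier {f : ℝ → ℂ} (hf : Integrable f) : Continuous (𝓕 f) :=
  VectorFourier.fourierIntegral_continuous Real.continuous_fourierChar
    (by exact continuous_inner) hf

theorem continuous_fourierInv {f : ℝ → ℂ} (hf : Integrable f) : Continuous (𝓕⁻ f) := by
  have : 𝓕⁻ f = fun x ↦ 𝓕 f (-x) := funext (Real.fourierInv_eq_fourier_neg f)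
  rw [this]
  exact (continuous_fourier hf).comp continuous_neg

theorem norm_fourier_le (f : ℝ → ℂ) (x : ℝ) : ‖𝓕 f x‖ ≤ ∫ y, ‖f y‖ :=
  VectorFourier.norm_fourierIntegral_le_integral_norm _ _ _ _ _

theorem norm_fourierInv_le (f : ℝ → ℂ) (x : ℝ) : ‖𝓕⁻ f x‖ ≤ ∫ y, ‖f y‖ := by
  rw [Real.fourierInv_eq_fourier_neg]; exact norm_fourier_le f _

theorem integral_fourier_mul {f g : ℝ → ℂ} (hf : Integrable f) (hg : Integrable g) :
    ∫ ξ, 𝓕 f ξ * g ξ = ∫ x, f x * 𝓕 g x := by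
  have := VectorFourier.integral_bilin_fourierIntegral_eq_flip (ContinuousLinearMap.mul ℂ ℂ)
    (L := innerₗ ℝ) Real.continuous_fourierChar continuous_inner hf hg
  simpa using! this

theorem integral_fourierInv_mul {f g : ℝ → ℂ} (hf : Integrable f) (hg : Integrable g) :
    ∫ ξ, 𝓕⁻ f ξ * g ξ = ∫ x, f x * 𝓕⁻ g x := by
  have := integral_fourier_mul hf.comp_neg hg
  rw [← integral_neg_eq_self (fun x ↦ f x * 𝓕⁻ g x)]
  simp_rw [Real.fourierInv_eq_fourier_comp_neg f, Real.fourierInv_eq_fourier_neg g, neg_neg]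
  exact this

/-- The `L²` transform and the integral define the same distribution: both are paired with smooth
compactly supported functions, and the transform is moved onto the test function. -/
theorem fourier_ae_eq {f : ℝ → ℂ} (h1 : Integrable f) (h2 : MemLp f 2) :
    (𝓕 (h2.toLp f) : Lp ℂ 2 (volume : Measure ℝ)) =ᵐ[volume] 𝓕 f := by
  refine ae_eq_of_integral_contDiff_smul_eq
    ((Lp.memLp _).locallyIntegrable (by norm_num)) (continuous_fourier h1).locallyIntegrable ?_
  intro g hg hgc
  have hg₁ : HasCompactSupport (Complex.ofRealCLM ∘ g) := hgc.comp_left rfl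
  have hg₂ : ContDiff ℝ (⊤ : ℕ∞) (Complex.ofRealCLM ∘ g) := by fun_prop
  set ψ : 𝓢(ℝ, ℂ) := hg₁.toSchwartzMap hg₂ with hψ
  have hψg : ∀ x, ψ x = (g x : ℂ) := fun x ↦ rfl
  have e := congrArg (fun T : 𝓢'(ℝ, ℂ) ↦ T ψ) (Lp.fourier_toTemperedDistribution_eq (h2.toLp f))
  simp only [TemperedDistribution.fourier_apply, Lp.toTemperedDistribution_apply, smul_eq_mul] at e
  have e1 : ∫ x, g x • (𝓕 (h2.toLp f) : Lp ℂ 2 (volume : Measure ℝ)) x =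
      ∫ x, ψ x * (𝓕 (h2.toLp f) : Lp ℂ 2 (volume : Measure ℝ)) x := by
    simp [hψg]
  have e2 : ∫ x, g x • 𝓕 f x = ∫ x, ψ x * 𝓕 f x := by
    simp [hψg]
  rw [e1, e2, ← e, ← integral_fourier_mul ψ.integrable h1, SchwartzMap.fourier_coe]
  refine integral_congr_ae ?_
  filter_upwards [h2.coeFn_toLp] with x hx
  rw [hx]

theorem eLpNorm_fourier {f : ℝ → ℂ} (h1 : Integrable f) (h2 : MemLp f 2) :
    eLpNorm (𝓕 f) 2 volume = eLpNorm f 2 volume := by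
  have h : ‖(𝓕 (h2.toLp f) : Lp ℂ 2 (volume : Measure ℝ))‖ₑ = ‖h2.toLp f‖ₑ := by
    rw [← ofReal_norm, ← ofReal_norm, Lp.norm_fourier_eq]
  rw [Lp.enorm_def, Lp.enorm_def, eLpNorm_congr_ae (fourier_ae_eq h1 h2),
    eLpNorm_congr_ae h2.coeFn_toLp] at h
  exact h

theorem eLpNorm_fourierInv {f : ℝ → ℂ} (h1 : Integrable f) (h2 : MemLp f 2) :
    eLpNorm (𝓕⁻ f) 2 volume = eLpNorm f 2 volume := by
  have : 𝓕⁻ f = 𝓕 f ∘ fun x ↦ -x := funext (Real.fourierInv_eq_fourier_neg f)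
  rw [this, eLpNorm_comp_measurePreserving (continuous_fourier h1).aestronglyMeasurable
    (Measure.measurePreserving_neg volume), eLpNorm_fourier h1 h2]

/-! ### The bilinear form of a multiplier and its endpoint bounds -/

/-- The bilinear form `∫ (m(D) f) g`, written on the Fourier side. -/
noncomputable def multiplierForm (m : ℝ → ℂ) (f g : ℝ → ℂ) : ℂ :=
  ∫ ξ, 𝓕 f ξ * (m ξ * 𝓕⁻ g ξ)

section MultiplierForm

variable {m : ℝ → ℂ}

theorem integrable_mul_fourierInv (hm : Integrable m) {g : ℝ → ℂ} (hg : Integrable g) :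
    Integrable fun ξ ↦ m ξ * 𝓕⁻ g ξ :=
  hm.mul_bdd (c := ∫ y, ‖g y‖) (continuous_fourierInv hg).aestronglyMeasurable
    (Filter.Eventually.of_forall (norm_fourierInv_le g))

theorem integrable_multiplierForm (hm : Integrable m) {f g : ℝ → ℂ} (hf : Integrable f)
    (hg : Integrable g) : Integrable fun ξ ↦ 𝓕 f ξ * (m ξ * 𝓕⁻ g ξ) :=
  (integrable_mul_fourierInv hm hg).bdd_mul (c := ∫ y, ‖f y‖)
    (continuous_fourier hf).aestronglyMeasurable
    (Filter.Eventually.of_forall (norm_fourier_le f))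

theorem fourier_add_apply {f g : ℝ → ℂ} (hf : Integrable f) (hg : Integrable g) (ξ : ℝ) :
    𝓕 (f + g) ξ = 𝓕 f ξ + 𝓕 g ξ :=
  congrFun (VectorFourier.fourierIntegral_add (L := innerₗ ℝ) Real.continuous_fourierChar
    continuous_inner hf hg) ξ

theorem fourier_smul_apply (c : ℂ) (f : ℝ → ℂ) (ξ : ℝ) : 𝓕 (c • f) ξ = c * 𝓕 f ξ :=
  congrFun (VectorFourier.fourierIntegral_const_smul _ _ _ f c) ξ

theorem isBilinearOnL1_multiplierForm (hm : Integrable m) :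
    IsBilinearOnL1 volume (multiplierForm m) where
  add_left f₁ f₂ g h₁ h₂ hg := by
    simp only [multiplierForm]
    rw [← integral_add (integrable_multiplierForm hm h₁ hg) (integrable_multiplierForm hm h₂ hg)]
    simp only [fourier_add_apply h₁ h₂, add_mul]
  smul_left c f g := by
    simp only [multiplierForm]
    rw [← integral_const_mul]
    simp only [fourier_smul_apply, mul_assoc]
  add_right f g₁ g₂ hf h₁ h₂ := by
    simp only [multiplierForm]
    rw [← integral_add (integrable_multiplierForm hm hf h₁) (integrable_multiplierForm hm hf h₂)]
    simp only [Real.fourierInv_eq_fourier_neg, fourier_add_apply h₁ h₂, mul_add]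
  smul_right c f g := by
    simp only [multiplierForm]
    rw [← integral_const_mul]
    simp only [Real.fourierInv_eq_fourier_neg, fourier_smul_apply]
    congr 1
    funext ξ
    ring

/-- Modulating `m` translates its kernel, so the left side is `∫ 𝓕⁻ m (x - y) g(x) dx`, a kernel
bounded by `A` integrated against `g`. -/
theorem norm_fourier_mul_fourierInv_le (hm : Integrable m) {A : ℝ} (hA : ∀ x, ‖𝓕⁻ m x‖ ≤ A)
    {g : ℝ → ℂ} (hg : Integrable g) (y : ℝ) :
    ‖𝓕 (fun ξ ↦ m ξ * 𝓕⁻ g ξ) y‖ ≤ A * ∫ x, ‖g x‖ := by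
  set my : ℝ → ℂ := fun ξ ↦ Real.fourierChar (-(ξ * y)) • m ξ with hmy
  have hmyi : Integrable my := by
    refine hm.mono (by fun_prop) (Filter.Eventually.of_forall fun ξ ↦ ?_)
    simp [hmy, Circle.norm_smul]
  have e1 : 𝓕 (fun ξ ↦ m ξ * 𝓕⁻ g ξ) y = ∫ ξ, my ξ * 𝓕⁻ g ξ := by
    rw [Real.fourier_real_eq]
    simp only [hmy, smul_mul_assoc]
  have e2 : ∀ x, ‖𝓕⁻ my x‖ ≤ A := by
    intro x
    have : 𝓕⁻ my x = 𝓕⁻ m (x - y) := by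
      rw [Real.fourierInv_eq_fourier_neg, Real.fourierInv_eq_fourier_neg, Real.fourier_real_eq,
        Real.fourier_real_eq]
      congr 1
      funext ξ
      rw [hmy]
      simp only [smul_smul]
      rw [← AddChar.map_add_eq_mul]
      congr 2
      ring
    rw [this]; exact hA _
  rw [e1, ← integral_fourierInv_mul hmyi hg, ← integral_const_mul]
  refine norm_integral_le_of_norm_le (hg.norm.const_mul A) (Filter.Eventually.of_forall fun x ↦ ?_)
  rw [norm_mul]
  exact mul_le_mul_of_nonneg_right (e2 x) (norm_nonneg _)

theorem norm_multiplierForm_le_L1 (hm : Integrable m) {A : ℝ} (hA : ∀ x, ‖𝓕⁻ m x‖ ≤ A)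
    {f g : ℝ → ℂ} (hf : Integrable f) (hg : Integrable g) :
    ‖multiplierForm m f g‖ ≤ A * ((∫ x, ‖f x‖) * ∫ x, ‖g x‖) := by
  rw [multiplierForm, integral_fourier_mul hf (integrable_mul_fourierInv hm hg),
    show A * ((∫ x, ‖f x‖) * ∫ x, ‖g x‖) = (∫ x, ‖f x‖) * (A * ∫ x, ‖g x‖) by ring,
    ← integral_mul_const]
  refine norm_integral_le_of_norm_le (hf.norm.mul_const _) (Filter.Eventually.of_forall fun x ↦ ?_)
  rw [norm_mul]
  exact mul_le_mul_of_nonneg_left (norm_fourier_mul_fourierInv_le hm hA hg x) (norm_nonneg _)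

/-- Cauchy–Schwarz on the Fourier side, then Plancherel. -/
theorem norm_multiplierForm_le_L2 (hm1 : ∀ ξ, ‖m ξ‖ ≤ 1)
    {f g : ℝ → ℂ} (hf : Integrable f) (hg : Integrable g) (hf2 : MemLp f 2) (hg2 : MemLp g 2) :
    ‖multiplierForm m f g‖ ≤
      (∫ x, ‖f x‖ ^ (2 : ℝ)) ^ (1 / 2 : ℝ) * (∫ x, ‖g x‖ ^ (2 : ℝ)) ^ (1 / 2 : ℝ) := by
  have hF : MemLp (𝓕 f) 2 := ⟨(continuous_fourier hf).aestronglyMeasurable, by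
    rw [eLpNorm_fourier hf hf2]; exact hf2.2⟩
  have hG : MemLp (𝓕⁻ g) 2 := ⟨(continuous_fourierInv hg).aestronglyMeasurable, by
    rw [eLpNorm_fourierInv hg hg2]; exact hg2.2⟩
  have hnorm : ∀ {u : ℝ → ℂ}, MemLp u 2 →
      (∫ x, ‖u x‖ ^ (2 : ℝ)) ^ (1 / 2 : ℝ) = (eLpNorm u 2 volume).toReal := fun {u} hu ↦ by
    rw [hu.eLpNorm_eq_integral_rpow_norm two_ne_zero ENNReal.ofNat_ne_top, ENNReal.toReal_ofReal,
      one_div]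
    · simp
    · exact Real.rpow_nonneg (integral_nonneg fun x ↦ by positivity) _
  have hH := integral_mul_norm_le_Lp_mul_Lq Real.HolderConjugate.two_two (f := 𝓕 f) (g := 𝓕⁻ g)
    (μ := volume) (by simpa using hF) (by simpa using hG)
  rw [hnorm hF, hnorm hG, eLpNorm_fourier hf hf2, eLpNorm_fourierInv hg hg2, ← hnorm hf2,
    ← hnorm hg2] at hH
  refine le_trans ?_ hH
  refine norm_integral_le_of_norm_le ?_ (Filter.Eventually.of_forall fun ξ ↦ ?_)
  · have := hF.norm.integrable_mul hG.norm
    exact this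
  · rw [norm_mul, norm_mul]
    refine mul_le_mul_of_nonneg_left ?_ (norm_nonneg _)
    exact mul_le_of_le_one_left (norm_nonneg _) (hm1 ξ)

end MultiplierForm

/-! ### From the bilinear form to the `L^{p'} → L^p` bound -/

section

variable {m : ℝ → ℂ}

theorem fourierMultiplier_apply (hmt : m.HasTemperateGrowth) (f : 𝓢(ℝ, ℂ)) (x : ℝ) :
    SchwartzMap.fourierMultiplierCLM ℂ m f x = 𝓕⁻ (fun ξ ↦ m ξ * 𝓕 (f : ℝ → ℂ) ξ) x := by
  rw [SchwartzMap.fourierMultiplierCLM_apply, SchwartzMap.fourierInv_coe]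
  refine congrArg (fun u : ℝ → ℂ ↦ 𝓕⁻ u x) (funext fun ξ ↦ ?_)
  rw [SchwartzMap.smulLeftCLM_apply_apply hmt, SchwartzMap.fourier_coe, smul_eq_mul]

theorem norm_fourierMultiplier_le (hmt : m.HasTemperateGrowth) (hm : Integrable m) {A : ℝ}
    (hA : ∀ x, ‖𝓕⁻ m x‖ ≤ A) (f : 𝓢(ℝ, ℂ)) (x : ℝ) :
    ‖SchwartzMap.fourierMultiplierCLM ℂ m f x‖ ≤ A * ∫ y, ‖f y‖ := by
  -- Reflecting both `f` and the evaluation point exchanges `𝓕` and `𝓕⁻`.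
  have h := norm_fourier_mul_fourierInv_le hm hA f.integrable.comp_neg (-x)
  rw [integral_neg_eq_self (fun y ↦ ‖f y‖)] at h
  rw [fourierMultiplier_apply hmt, Real.fourierInv_eq_fourier_neg]
  convert h using 5 with ξ
  rw [Real.fourierInv_eq_fourier_comp_neg]
  simp

theorem integral_fourierMultiplier_mul (hmt : m.HasTemperateGrowth) (hm : Integrable m)
    (f : 𝓢(ℝ, ℂ)) {g : ℝ → ℂ} (hg : Integrable g) :
    ∫ x, SchwartzMap.fourierMultiplierCLM ℂ m f x * g x = multiplierForm m f g := by
  simp_rw [fourierMultiplier_apply hmt]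
  rw [integral_fourierInv_mul (hm.mul_bdd (c := ∫ y, ‖f y‖)
    (continuous_fourier f.integrable).aestronglyMeasurable
    (Filter.Eventually.of_forall (norm_fourier_le f))) hg, multiplierForm]
  congr 1
  funext ξ
  ring

theorem eLpNorm_fourierMultiplier_le (hmt : m.HasTemperateGrowth) (hm : Integrable m)
    (hm1 : ∀ ξ, ‖m ξ‖ ≤ 1) {A : ℝ} (hA0 : 0 ≤ A) (hA : ∀ x, ‖𝓕⁻ m x‖ ≤ A)
    {p p' : ℝ≥0∞} (hp : 2 ≤ p) (hpp' : 1 / p + 1 / p' = 1) (f : 𝓢(ℝ, ℂ)) :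
    eLpNorm (SchwartzMap.fourierMultiplierCLM ℂ m f) p volume ≤
      ENNReal.ofReal (A ^ (2 * (1 / 2 - (1 / p).toReal))) * eLpNorm f p' volume := by
  set h := SchwartzMap.fourierMultiplierCLM ℂ m f with hh
  rcases eq_or_ne p ∞ with rfl | hptop
  · have hp' : p' = 1 := by simpa using hpp'
    have e : (2 * (1 / 2 - (1 / (∞ : ℝ≥0∞)).toReal) : ℝ) = 1 := by simp
    rw [e, Real.rpow_one, hp', eLpNorm_exponent_top]
    refine (eLpNormEssSup_le_of_ae_bound (C := A * ∫ y, ‖f y‖)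
      (Filter.Eventually.of_forall (norm_fourierMultiplier_le hmt hm hA f))).trans (le_of_eq ?_)
    rw [ENNReal.ofReal_mul hA0, ofReal_integral_norm_eq_lintegral_enorm f.integrable,
      eLpNorm_one_eq_lintegral_enorm]
  · have hp0 : p ≠ 0 := (zero_lt_two.trans_le hp).ne'
    set r := p.toReal with hr
    have hr2 : 2 ≤ r := by
      have := ENNReal.toReal_mono hptop hp
      simpa using this
    have hpinv : (1 / p).toReal = 1 / r := by simp [hr]
    have hp'inv : 1 / p' ≠ ∞ := fun hc ↦ by rw [hc] at hpp'; simp at hpp'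
    have hsum : 1 / r + (1 / p').toReal = 1 := by
      rw [← hpinv, ← ENNReal.toReal_add _ hp'inv, hpp', ENNReal.toReal_one]
      simpa using hp0
    set s := p'.toReal with hs
    have hs' : (1 / p').toReal = 1 / s := by simp [hs]
    rw [hs'] at hsum
    have h1r : 1 / r ≤ 1 / 2 := one_div_le_one_div_of_le two_pos hr2
    have h1r0 : 0 < 1 / r := by positivity
    have hs0 : 0 < s := one_div_pos.1 (by linarith)
    have hp'top : p' ≠ ∞ := fun hc ↦ by rw [hs, hc] at hs0; simp at hs0
    have hp'1 : 1 ≤ p' := by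
      rw [← ENNReal.ofReal_toReal hp'top, ← hs, ENNReal.one_le_ofReal]
      exact (div_le_one hs0).1 (by linarith)
    have hp'0 : p' ≠ 0 := (zero_lt_one.trans_le hp'1).ne'
    have hrs : (r - 1) * s = r := by
      field_simp at hsum
      linarith
    -- The extremal function of Hölder duality: `h g = |h|^p` and `|g|^{p'} = |h|^p`. It is
    -- continuous because `p ≥ 2`, and its integrability comes from the decay of the Schwartz
    -- function `h`.
    set g : ℝ → ℂ := fun x ↦ (starRingEnd ℂ) (h x) * ((‖h x‖ ^ (r - 2) : ℝ) : ℂ) with hg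
    have hgc : Continuous g := by
      have : Continuous fun x ↦ ‖h x‖ ^ (r - 2) :=
        h.continuous.norm.rpow_const fun x ↦ Or.inr (by linarith)
      have := h.continuous
      fun_prop
    have hgn : ∀ x, ‖g x‖ = ‖h x‖ ^ (r - 1) := by
      intro x
      rw [hg]
      simp only [norm_mul, RCLike.norm_conj, Complex.norm_real,
        Real.norm_of_nonneg (Real.rpow_nonneg (norm_nonneg (h x)) (r - 2))]
      rw [show r - 1 = 1 + (r - 2) by ring,
        Real.rpow_one_add' (norm_nonneg _) (by linarith)]
    have hgh : ∀ x, h x * g x = ((‖h x‖ ^ r : ℝ) : ℂ) := by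
      intro x
      rw [hg]
      simp only
      rw [← mul_assoc, Complex.mul_conj, Complex.normSq_eq_norm_sq, ← Complex.ofReal_mul,
        ← Real.rpow_natCast, ← Real.rpow_add' (norm_nonneg _) (by push_cast; linarith)]
      congr 2
      push_cast
      ring
    have hInt : ∀ a : ℝ, 0 < a → Integrable fun x ↦ ‖h x‖ ^ a := fun a ha ↦ by
      have := (h.memLp (ENNReal.ofReal a) volume).integrable_norm_rpow
        (by simpa using ha) ENNReal.ofReal_ne_top
      rwa [ENNReal.toReal_ofReal ha.le] at this
    have hgi : Integrable g := by
      refine (hInt (r - 1) (by linarith)).mono' hgc.aestronglyMeasurable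
        (Filter.Eventually.of_forall fun x ↦ (hgn x).le)
    have hgns : ∀ x, ‖g x‖ ^ s = ‖h x‖ ^ r := fun x ↦ by
      rw [hgn, ← Real.rpow_mul (norm_nonneg _), hrs]
    have hgq : MemLp g p' := by
      rw [← integrable_norm_rpow_iff hgc.aestronglyMeasurable hp'0 hp'top]
      simp_rw [← hs, hgns]
      exact hInt r (by linarith)
    have hfq : MemLp f p' := f.memLp p' volume
    have key := norm_bilinear_le (isBilinearOnL1_multiplierForm hm) hA0
      (fun _ _ ↦ norm_multiplierForm_le_L1 hm hA) (fun _ _ ↦ norm_multiplierForm_le_L2 hm1)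
      (θ := 2 / r) (by positivity) (by rw [div_le_one (by linarith)]; exact hr2) hp'1 hp'top
      (by rw [← hs]; field_simp at hsum ⊢; linarith)
      f.continuous.measurable hgc.measurable f.integrable hgi hfq hgq
    rw [← integral_fourierMultiplier_mul hmt hm f hgi, ← hh] at key
    simp_rw [hgh] at key
    set N := ∫ x, ‖h x‖ ^ r with hN
    have hN0 : 0 ≤ N := integral_nonneg fun x ↦ by positivity
    rw [integral_complex_ofReal, Complex.norm_real, ← hN, Real.norm_of_nonneg hN0,
      hgq.eLpNorm_eq_integral_rpow_norm hp'0 hp'top, ← hs] at key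
    simp_rw [hgns] at key
    rw [← hN, ENNReal.toReal_ofReal (by positivity)] at key
    rw [(h.memLp p volume).eLpNorm_eq_integral_rpow_norm hp0 hptop, ← hr, ← hN,
      ← ENNReal.ofReal_toReal hfq.2.ne, ← ENNReal.ofReal_mul (by positivity)]
    refine ENNReal.ofReal_le_ofReal ?_
    rw [hpinv, show 2 * (1 / 2 - 1 / r) = 1 - 2 / r by ring]
    -- Interpolation has given `N ≤ A^{1-2/p} ‖f‖_{p'} N^{1/p'}`. Dividing by `N^{1/p'}` leaves
    -- `N^{1/p} = ‖h‖_p`, once `N = 0` is set aside.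
    rcases hN0.eq_or_lt with h0 | h0
    · rw [← h0, Real.zero_rpow (by positivity)]
      positivity
    · have hNs : 0 < N ^ s⁻¹ := Real.rpow_pos_of_pos h0 _
      have e : N = N ^ r⁻¹ * N ^ s⁻¹ := by
        rw [← Real.rpow_add h0, ← one_div, ← one_div, hsum, Real.rpow_one]
      refine le_of_mul_le_mul_right ?_ hNs
      rw [← e]
      linarith

end

/-! ### The symbol of `J^σ S(t)` and the conclusion -/

/-- The symbol of `J^σ S(t)`, in the normalization of Mathlib's Fourier transform. -/
noncomputable def kernelSymbol (σ t ξ : ℝ) : ℂ :=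
  groupSymbol t (2 * Real.pi * ξ) * besselSymbol σ (2 * Real.pi * ξ)

theorem hasTemperateGrowth_kernelSymbol (σ t : ℝ) : (kernelSymbol σ t).HasTemperateGrowth :=
  (hasTemperateGrowth_groupSymbol t).mul (hasTemperateGrowth_besselSymbol σ)

theorem exp_mul_kernelSymbol (σ x t ξ : ℝ) :
    Complex.exp ((x * (2 * Real.pi * ξ) : ℝ) * Complex.I) * kernelSymbol σ t ξ =
      kernelIntegrand σ x t (2 * Real.pi * ξ) := by
  rw [kernelSymbol, kernelIntegrand, groupSymbol, besselSymbol, ← mul_assoc, ← Complex.exp_add]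
  congr 2
  push_cast
  ring

theorem kernelSymbol_eq (σ t ξ : ℝ) :
    kernelSymbol σ t ξ = kernelIntegrand σ 0 t (2 * Real.pi * ξ) := by
  rw [← exp_mul_kernelSymbol]
  simp

theorem integrable_kernelSymbol {σ : ℝ} (hσ : σ < -1) (t : ℝ) : Integrable (kernelSymbol σ t) := by
  have : kernelSymbol σ t = fun ξ ↦ kernelIntegrand σ 0 t (2 * Real.pi * ξ) :=
    funext (kernelSymbol_eq σ t)
  rw [this]
  exact (integrable_kernelIntegrand hσ 0 t).comp_mul_left' (by positivity)

theorem norm_kernelSymbol_le_one {σ : ℝ} (hσ : σ < -1) (t ξ : ℝ) : ‖kernelSymbol σ t ξ‖ ≤ 1 := by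
  rw [kernelSymbol_eq, norm_kernelIntegrand]
  exact bracket_rpow_le_one (by linarith) _

theorem fourierInv_kernelSymbol (σ t x : ℝ) :
    𝓕⁻ (kernelSymbol σ t) x = ((2 * Real.pi)⁻¹ : ℝ) • ∫ η, kernelIntegrand σ x t η := by
  have h := Measure.integral_comp_mul_left (kernelIntegrand σ x t) (2 * Real.pi)
  rw [abs_of_pos (by positivity)] at h
  rw [← h, Real.fourierInv_eq']
  congr 1
  funext ξ
  rw [← exp_mul_kernelSymbol, smul_eq_mul]
  congr 2
  simp
  ring

theorem bessel_group_apply (σ t : ℝ) (f : 𝓢(ℝ, ℂ)) :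
    bessel σ (group t (f : 𝓢'(ℝ, ℂ))) =
      (SchwartzMap.fourierMultiplierCLM ℂ (kernelSymbol σ t) f : 𝓢(ℝ, ℂ)) := by
  rw [bessel, group, multiplier, multiplier,
    TemperedDistribution.fourierMultiplierCLM_fourierMultiplierCLM_apply
      (hasTemperateGrowth_groupSymbol t) (hasTemperateGrowth_besselSymbol σ)]
  exact TemperedDistribution.fourierMultiplierCLM_toTemperedDistributionCLM_eq
    (hasTemperateGrowth_kernelSymbol σ t) f

/-- `J^σ S(t) f` is itself a Schwartz function, hence an admissible representative in the infimum.
-/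
theorem sobolevNorm_group_le (σ t : ℝ) (p : ℝ≥0∞) (f : 𝓢(ℝ, ℂ)) :
    sobolevNorm σ p (group t (f : 𝓢'(ℝ, ℂ))) ≤
      eLpNorm (SchwartzMap.fourierMultiplierCLM ℂ (kernelSymbol σ t) f) p volume := by
  refine iInf_le_of_le (SchwartzMap.fourierMultiplierCLM ℂ (kernelSymbol σ t) f)
    (iInf_le_of_le (SchwartzMap.memLp _ p volume) (iInf_le_of_le (fun ψ ↦ ?_) le_rfl))
  rw [bessel_group_apply]
  simp

end BBM

/-- For `σ < -1` there is a constant `C_σ > 0`, depending on `σ` only, such that for all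
`2 ≤ p ≤ ∞`, `1/p + 1/p' = 1`, all Schwartz functions `f` and all `t ≠ 0`,
`‖S(t) f‖_{H^σ_p} ≤ C_σ |t|^{2 (1/2 - 1/p) β_σ} ‖f‖_{L^{p'}}`. -/
theorem mainTheorem9 (σ : ℝ) (hσ : σ < -1) :
    ∃ C : ℝ, 0 < C ∧
      ∀ p p' : ℝ≥0∞, 2 ≤ p → 1 / p + 1 / p' = 1 →
        ∀ (f : 𝓢(ℝ, ℂ)) (t : ℝ), t ≠ 0 →
          BBM.sobolevNorm σ p (BBM.group t (f : 𝓢'(ℝ, ℂ))) ≤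
            ENNReal.ofReal (C * |t| ^ (2 * (1 / 2 - (1 / p).toReal) * BBM.beta σ)) *
              eLpNorm f p' volume := by
  obtain ⟨C, hC, hK⟩ := BBM.exists_norm_integral_kernelIntegrand_le hσ
  -- The exponent `2(1/2 - 1/p)` is at most `1`, so with a base at least `1` the power is bounded by
  -- the base, and the constant does not depend on `p`.
  refine ⟨max 1 C, by positivity, fun p p' hp hpp' f t ht ↦ ?_⟩
  have ht' : 0 < |t| := abs_pos.2 ht
  have hA : ∀ x, ‖FourierTransform.fourierInv (BBM.kernelSymbol σ t) x‖ ≤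
      max 1 C * |t| ^ BBM.beta σ := by
    intro x
    rw [BBM.fourierInv_kernelSymbol, norm_smul, Real.norm_of_nonneg (by positivity)]
    have h1 : (2 * Real.pi)⁻¹ ≤ 1 := inv_le_one_of_one_le₀ (by linarith [Real.pi_gt_three])
    refine (mul_le_of_le_one_left (norm_nonneg _) h1).trans ((hK x t ht).trans ?_)
    exact mul_le_mul_of_nonneg_right (le_max_right _ _) (by positivity)
  refine (BBM.sobolevNorm_group_le σ t p f).trans ((BBM.eLpNorm_fourierMultiplier_le
    (BBM.hasTemperateGrowth_kernelSymbol σ t) (BBM.integrable_kernelSymbol hσ t)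
    (BBM.norm_kernelSymbol_le_one hσ t) (by positivity) hA hp hpp' f).trans ?_)
  gcongr
  have hpr : (1 / p).toReal ≤ 1 / 2 := by
    have := ENNReal.toReal_mono (by simp) (ENNReal.inv_le_inv.2 hp)
    simpa using this
  have hpr0 : 0 ≤ (1 / p).toReal := ENNReal.toReal_nonneg
  rw [Real.mul_rpow (by positivity) (by positivity), ← Real.rpow_mul ht'.le,
    mul_comm (BBM.beta σ)]
  refine mul_le_mul_of_nonneg_right ?_ (by positivity)
  calc max 1 C ^ (2 * (1 / 2 - (1 / p).toReal)) ≤ max 1 C ^ (1 : ℝ) :=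
        Real.rpow_le_rpow_of_exponent_le (le_max_left _ _) (by linarith)
    _ = max 1 C := Real.rpow_one _
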